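/- A ribbon graph $G=(V,E)$ is a (compact) surface with boundary, represented as the union of a finite set $V$ of vertex discs and a finite set $E$ of edge discs, such that vertices and edges meet in disjoint line segments, each such segment lies on the boundary of exactly one vertex and exactly one edge, and each edge contains exactly two such segments. Ribbon graphs are considered up to homeomorphisms preserving this structure. For $A\subseteq E$ let $f(A)$ and $k(A)$ be the numbers of boundary components and of connected components of the spanning ribbon subgraph $(V,A)$, and put $k(G)=k(E)$. An edge $e$ is a bridge if $k(E\setminus\{e\})>k(G)$, and a loop if it is incident with exactly one vertex. A loop is non-orientable if, together with its vertex, it forms a Möbius band, and orientable otherwise. Two cycles $C_1,C_2$ of $G$ are interlaced if they have exactly one common vertex $v$ and are met in the cyclic order $C_1\,C_2\,C_1\,C_2$ when travelling around the boundary of $v$; a loop is trivial if it is interlaced with no cycle of $G$. Let $D(G)=(E,\mathcal F)$ with $\mathcal F=\{A\subseteq E : f(A)=k(G)\}$ be the delta-matroid of $G$. For a delta-matroid $D=(E,\mathcal F)$ and $e\in E$: $e$ is a loop (coloop) of $D$ if it lies in no (every) set of $\mathcal F$; $D_{\min}=(E,\mathcal F_{\min})$, where $\mathcal F_{\min}$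 consists of the members of $\mathcal F$ of minimum cardinality; $D*e=(E,\{F\bigtriangleup \{e\} : F\in\mathcal F\})$; $e$ is a ribbon loop of $D$ if it is a loop of $D_{\min}$; a ribbon loop $e$ of $D$ is non-orientable if it is also a ribbon loop of $D*e$, and orientable otherwise; an orientable ribbon loop $e$ is trivial if it lies in no set of $\mathcal F$; a non-orientable ribbon loop $e$ is trivial if $F\bigtriangleup\{e\}\in\mathcal F$ for every $F\in\mathcal F$. Proposition. Let $G$ be a ribbon graph and $e\in E$. Then 1. $e$ is a loop of $G$ if and only if $e$ is a ribbon loop of $D(G)$; 2. $e$ is an orientable loop of $G$ if and only if $e$ is an orientable ribbon loop of $D(G)$; 3. $e$ is a trivial loop of $G$ if and only if $e$ is a trivial ribbon loop of $D(G)$; 4. $e$ is a coloop of $D(G)$ if and only if $e$ is a bridge of $G$; 5. $e$ is a loop of $D(G)$ if and only if $e$ is a trivial orientable loop of $G$. -/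

import Mathlib

/-- A (finite) set system on the ground set `E`, given by its feasible sets. -/
structure SetSystem (E : Type*) where
  Feasible : Set E → Prop

namespace SetSystem

variable {E : Type*}

/-- The twist `D * A`: its feasible sets are the sets `A ∆ X` with `X` feasible in `D`. -/
def twist (D : SetSystem E) (A : Set E) : SetSystem E where
  Feasible F := ∃ X, D.Feasible X ∧ F = symmDiff A X

/-- `D_min`: the feasible sets of `D` of minimum cardinality. -/
def lower (D : SetSystem E) : SetSystem E where
  Feasible F := D.Feasible F ∧ ∀ F', D.Feasible F' → F.ncard ≤ F'.ncard

/-- A loop is an element that lies in no feasible set. -/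
def IsLoop (D : SetSystem E) (e : E) : Prop :=
  ∀ F, D.Feasible F → e ∉ F

/-- A coloop is an element that lies in every feasible set. -/
def IsColoop (D : SetSystem E) (e : E) : Prop :=
  ∀ F, D.Feasible F → e ∈ F

/-- A ribbon loop of `D` is a loop of `D_min`. -/
def IsRibbonLoop (D : SetSystem E) (e : E) : Prop :=
  D.lower.IsLoop e

/-- A ribbon loop `e` of `D` is non-orientable if it is also a ribbon loop of `D * e`. -/
def IsNonorientableRibbonLoop (D : SetSystem E) (e : E) : Prop :=
  D.IsRibbonLoop e ∧ (D.twist {e}).IsRibbonLoop e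

/-- A ribbon loop is orientable if it is not non-orientable. -/
def IsOrientableRibbonLoop (D : SetSystem E) (e : E) : Prop :=
  D.IsRibbonLoop e ∧ ¬ (D.twist {e}).IsRibbonLoop e

/-- An orientable ribbon loop is trivial if it lies in no feasible set; a non-orientable ribbon
loop `e` is trivial if `F ∆ e` is feasible for every feasible `F`. -/
def IsTrivialRibbonLoop (D : SetSystem E) (e : E) : Prop :=
  (D.IsOrientableRibbonLoop e ∧ ∀ F, D.Feasible F → e ∉ F) ∨
  (D.IsNonorientableRibbonLoop e ∧ ∀ F, D.Feasible F → D.Feasible (symmDiff F {e}))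

end SetSystem

/-- A ribbon graph with vertex set `V` and edge set `E`, up to equivalence, described by a signed
rotation system.

The edge disc `e` meets the vertex discs in two line segments, the half-edges `(e, false)` and
`(e, true)`. The half-edge `h` lies on the boundary of the vertex disc `vert h`. After choosing a
direction of travel around the boundary of each vertex disc, `rot h` is the half-edge met
immediately after `h`; so the half-edges on one vertex form one cycle of `rot`. A vertex may carry
no half-edges. Finally `twisted e` records whether the band `e` is attached
with a half-twist relative to the chosen directions at its two ends. -/
structure RibbonGraph (V E : Type*) where
  vert : E × Bool → V
  rot : Equiv.Perm (E × Bool)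
  vert_eq_iff : ∀ h h', vert h = vert h' ↔ rot.SameCycle h h'
  twisted : E → Bool

namespace RibbonGraph

variable {V E : Type*} (G : RibbonGraph V E)

/-- `u` and `v` are the end vertices of an edge of `A`. -/
def Joined (A : Set E) (u v : V) : Prop :=
  ∃ e ∈ A, G.vert (e, false) = u ∧ G.vert (e, true) = v

/-- `k(A)`: the number of connected components of the spanning ribbon subgraph `(V, A)`.
(`Quot` is the quotient by the equivalence relation generated by the given relation.) -/
noncomputable def k (A : Set E) : ℕ :=
  Nat.card (Quot (G.Joined A))

/-- The boundary of the spanning ribbon subgraph `(V, A)` is a union of arcs between the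
endpoints of half-edges (and of whole boundary circles of vertices without half-edges).
The segment `h` has the two endpoints `(h, false)` and `(h, true)`, in the order in which they are
met when travelling around `vert h`. The arcs are of three kinds:
* `corner`: the arc of the vertex boundary from the segment `h` to the next segment `rot h`;
* `free`: the segment `h` itself, if its edge is not in `A`;
* `side`: one of the two sides of an edge `e ∈ A`. A side of an untwisted edge joins the first
  endpoint of one of the segments of `e` to the second endpoint of the other one,
  a side of a twisted edge joins the first to the first, or the second to the second. -/
inductive BoundaryArc (A : Set E) : (E × Bool) × Bool → (E × Bool) × Bool → Prop
  | corner (h : E × Bool) : BoundaryArc A (h, true) (G.rot h, false)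
  | free (h : E × Bool) (hA : h.1 ∉ A) : BoundaryArc A (h, false) (h, true)
  | side (e : E) (hA : e ∈ A) (s : Bool) :
      BoundaryArc A ((e, false), s) ((e, true), xor s (!(G.twisted e)))

/-- `f(A)`: the number of boundary components of the spanning ribbon subgraph `(V, A)`. Each
vertex that carries no half-edge of `G` contributes one further boundary component. -/
noncomputable def f (A : Set E) : ℕ :=
  Nat.card (Quot (G.BoundaryArc A)) + Nat.card {v : V // ∀ h, G.vert h ≠ v}

/-- `D(G)`: the feasible sets are the edge sets `A` with `f(A) = k(G)`, that is, the edge sets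
of the spanning quasi-trees of `G`. -/
noncomputable def D : SetSystem E where
  Feasible A := G.f A = G.k Set.univ

/-- `e` is a bridge if `k(G \ e) > k(G)`. -/
def IsBridge (e : E) : Prop :=
  G.k Set.univ < G.k {e}ᶜ

/-- A loop is an edge that is incident with exactly one vertex. -/
def IsLoop (e : E) : Prop :=
  G.vert (e, false) = G.vert (e, true)

/-- An orientable loop: the band is attached without a half-twist to a single disc, so that the
loop is an annulus. A loop with a half-twist is a Möbius band. -/
def IsOrientableLoop (e : E) : Prop :=
  G.IsLoop e ∧ G.twisted e = false

/-- `C` is the edge set of a cycle of `G`: its edges can be traversed cyclically, passing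
through distinct vertices. (Addition in `Fin (n + 1)` is cyclic; loops are the cycles with
`n = 0`.) -/
def IsCycle (C : Set E) : Prop :=
  ∃ (n : ℕ) (h : Fin (n + 1) → E × Bool),
    Function.Injective (fun i => (h i).1) ∧
    Function.Injective (fun i => G.vert (h i)) ∧
    (∀ i, G.vert ((h i).1, !(h i).2) = G.vert (h (i + 1))) ∧
    C = Set.range (fun i => (h i).1)

/-- The vertices that are incident with an edge of `C`. -/
def vertices (C : Set E) : Set V :=
  {v | ∃ h : E × Bool, h.1 ∈ C ∧ G.vert h = v}

/-- The half-edges `a, b, c, d` lie on one vertex, are distinct, and are met in the cyclic order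
`a b c d` when travelling around its boundary. -/
def CyclicOrder (a b c d : E × Bool) : Prop :=
  ∃ i j k : ℕ, 0 < i ∧ i < j ∧ j < k ∧ k < Function.minimalPeriod G.rot a ∧
    G.rot^[i] a = b ∧ G.rot^[j] a = c ∧ G.rot^[k] a = d

/-- Two cycles are interlaced if they share exactly one vertex `v` and are met in the cyclic
order `C₁ C₂ C₁ C₂` around `v`. -/
def Interlaced (C₁ C₂ : Set E) : Prop :=
  ∃ v, G.vertices C₁ ∩ G.vertices C₂ = {v} ∧
    ∃ a b c d : E × Bool, a.1 ∈ C₁ ∧ b.1 ∈ C₂ ∧ c.1 ∈ C₁ ∧ d.1 ∈ C₂ ∧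
      G.vert a = v ∧ G.CyclicOrder a b c d

/-- A loop is trivial if it is interlaced with no cycle of `G`. -/
def IsTrivialLoop (e : E) : Prop :=
  G.IsLoop e ∧ ∀ C, G.IsCycle C → ¬ G.Interlaced {e} C

end RibbonGraph

/-!
Travelling along the boundary, one meets each edge band in four corner points, and these form a
torsor under the group `Bool × Bool`: an absent, an untwisted and a twisted band join them in two
pairs by the shifts `(0, 1)`, `(1, 1)` and `(1, 0)`. The rest of the boundary also joins them in
pairs, by some shift `p ≠ 0`, so among the three ways to fill in one edge, exactly one closes up
two curves (the shift `p`) where the other two close up one. Hence adding an edge between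
different components lowers `f` by one, the minimal feasible sets are the spanning forests, and
loops and bridges of `G` are read off from them.

For a loop `e`, let `G'` be the partial dual at `e` (with the half-twist of `e` removed). If `e` is
untwisted then `D(G') = D(G) * e`, and if it is twisted then, for `e ∉ A`, exactly one or all three
of `A ∈ D(G)`, `A ∪ e ∈ D(G)` and `A ∉ D(G')` hold. In `G'` the vertex of the loop is cut in
two, so that `e` is not a loop; a cycle interlaced with `e` becomes a path in `G' \ e` between the
two ends of `e`, so that `e` is a trivial loop of `G` if and only if it is a bridge of `G'`.
-/

/-- `x` and `y` are identified in `Quot r`, that is, related by the equivalence relation generated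
by `r`. -/
abbrev QuotEq {X : Type*} (r : X → X → Prop) (x y : X) : Prop :=
  Quot.mk r x = Quot.mk r y

theorem apply_eq_of_sameCycle {X Y : Type*} {ρ : Equiv.Perm X} {g : X → Y}
    (hg : ∀ x, g (ρ x) = g x) {x y : X} (hxy : ρ.SameCycle x y) : g x = g y := by
  obtain ⟨n, rfl⟩ := hxy
  induction n using Int.induction_on with
  | zero => rfl
  | succ n ih => rw [add_comm, zpow_one_add, Equiv.Perm.mul_apply, hg, ih]
  | pred n ih =>
    rw [ih, sub_eq_neg_add, zpow_add, zpow_neg_one, Equiv.Perm.mul_apply, Equiv.Perm.inv_def,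
      ← hg (ρ.symm _), Equiv.apply_symm_apply]

section QuotientCounting

variable {X Y : Type*} {r r' : X → X → Prop} {s : Y → Y → Prop} {x y u v : X}

theorem QuotEq.map (g : X → Y) (h : ∀ x y, r x y → QuotEq s (g x) (g y)) (hxy : QuotEq r x y) :
    QuotEq s (g x) (g y) :=
  congrArg (Quot.lift (fun x => Quot.mk s (g x)) h) hxy

theorem quotEq_congr (h : ∀ x y, r x y → QuotEq r' x y) (h' : ∀ x y, r' x y → QuotEq r x y) :
    QuotEq r x y ↔ QuotEq r' x y :=
  ⟨QuotEq.map id h, QuotEq.map id h'⟩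

theorem card_quot_congr (g : X → Y) (g' : Y → X) (h : ∀ x y, r x y → QuotEq s (g x) (g y))
    (h' : ∀ x y, s x y → QuotEq r (g' x) (g' y)) (left_inv : ∀ x, QuotEq r (g' (g x)) x)
    (right_inv : ∀ y, QuotEq s (g (g' y)) y) : Nat.card (Quot r) = Nat.card (Quot s) :=
  Nat.card_congr
    { toFun := Quot.lift (fun x => Quot.mk s (g x)) h
      invFun := Quot.lift (fun y => Quot.mk r (g' y)) h'
      left_inv := by rintro ⟨x⟩; exact left_inv x
      right_inv := by rintro ⟨y⟩; exact right_inv y }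

theorem card_quot_eq_of_quotEq (h : ∀ x y, r x y → QuotEq r' x y)
    (h' : ∀ x y, r' x y → QuotEq r x y) : Nat.card (Quot r) = Nat.card (Quot r') :=
  card_quot_congr id id h h' (fun _ => rfl) (fun _ => rfl)

theorem card_quot_le_of_surjective [Finite X] {g : X → Y} (hg : Function.Surjective g)
    (h : ∀ x y, r x y → QuotEq s (g x) (g y)) : Nat.card (Quot s) ≤ Nat.card (Quot r) :=
  Nat.card_le_card_of_surjective (Quot.lift (fun x => Quot.mk s (g x)) h) <| by
    rintro ⟨y⟩
    obtain ⟨x, rfl⟩ := hg y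
    exact ⟨Quot.mk r x, rfl⟩

/-- The relation `r` with the pair `(x, y)` added: its quotient glues `x` to `y` in `Quot r`. -/
def AdjoinPair (r : X → X → Prop) (x y u v : X) : Prop :=
  r u v ∨ (u = x ∧ v = y)

theorem AdjoinPair.of_quotEq (h : QuotEq r u v) : QuotEq (AdjoinPair r x y) u v :=
  QuotEq.map id (fun _ _ h => Quot.sound (.inl h)) h

theorem AdjoinPair.quotEq : QuotEq (AdjoinPair r x y) x y :=
  Quot.sound (.inr ⟨rfl, rfl⟩)

open Classical in
theorem adjoinPair_iff : QuotEq (AdjoinPair r x y) u v ↔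
    QuotEq r u v ∨ (QuotEq r u x ∧ QuotEq r v y) ∨ (QuotEq r u y ∧ QuotEq r v x) := by
  constructor
  · let collapse (w : X) : Quot r := if QuotEq r w y then Quot.mk r x else Quot.mk r w
    have collapse_congr : ∀ w w', AdjoinPair r x y w w' → collapse w = collapse w' := by
      rintro w w' (h | ⟨rfl, rfl⟩)
      · simp only [collapse, QuotEq, Quot.sound h]
      · simp only [collapse, if_true, ite_self]
    intro h
    have : collapse u = collapse v := congrArg (Quot.lift collapse collapse_congr) h
    simp only [collapse] at this
    split_ifs at this with hu hv hv
    · exact .inl (hu.trans hv.symm)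
    · exact .inr (.inr ⟨hu, this.symm⟩)
    · exact .inr (.inl ⟨this, hv⟩)
    · exact .inl this
  · rintro (h | ⟨hu, hv⟩ | ⟨hu, hv⟩)
    · exact AdjoinPair.of_quotEq h
    · exact (AdjoinPair.of_quotEq hu).trans (AdjoinPair.quotEq.trans
        (AdjoinPair.of_quotEq hv).symm)
    · exact (AdjoinPair.of_quotEq hu).trans (AdjoinPair.quotEq.symm.trans
        (AdjoinPair.of_quotEq hv).symm)

theorem card_adjoinPair_of_quotEq (h : QuotEq r x y) :
    Nat.card (Quot (AdjoinPair r x y)) = Nat.card (Quot r) := by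
  refine card_quot_eq_of_quotEq ?_ fun u v huv => AdjoinPair.of_quotEq (Quot.sound huv)
  rintro u v (huv | ⟨rfl, rfl⟩)
  exacts [Quot.sound huv, h]

theorem card_adjoinPair_of_not_quotEq [Finite X] (h : ¬ QuotEq r x y) :
    Nat.card (Quot (AdjoinPair r x y)) + 1 = Nat.card (Quot r) := by
  let project : {q : Quot r // q ≠ Quot.mk r y} → Quot (AdjoinPair r x y) :=
    fun q => Quot.map id (fun _ _ => .inl) q.1
  have project_bijective : Function.Bijective project := by
    constructor
    · rintro ⟨⟨u⟩, hu⟩ ⟨⟨v⟩, hv⟩ huv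
      rcases adjoinPair_iff.1 huv with huv | ⟨-, hv'⟩ | ⟨hu', -⟩
      exacts [Subtype.ext huv, (hv hv').elim, (hu hu').elim]
    · rintro ⟨u⟩
      by_cases hu : QuotEq r u y
      · exact ⟨⟨Quot.mk r x, h⟩, AdjoinPair.quotEq.trans (AdjoinPair.of_quotEq hu.symm)⟩
      · exact ⟨⟨Quot.mk r u, hu⟩, rfl⟩
  rw [← Nat.card_eq_of_bijective project project_bijective]
  have := Set.ncard_add_ncard_compl {Quot.mk r y}
  rw [Set.ncard_singleton] at this
  rw [← this, add_comm]
  rfl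

end QuotientCounting

section Pairing

variable {X : Type*} {r s : X → X → Prop} {Q : Set X} {x y : X}

/-- Every point of `Q` is identified in `Quot r` with exactly one other point of `Q`. This is the
situation of a union of arcs with set of ends `Q`. -/
def IsPairing (r : X → X → Prop) (Q : Set X) : Prop :=
  ∀ b ∈ Q, ∃ c ∈ Q, c ≠ b ∧ ∀ q ∈ Q, QuotEq r q b ↔ q = b ∨ q = c

theorem isPairing_univ_of_involutive {c : X → X} (hc : Function.Involutive c)
    (hne : ∀ x, c x ≠ x) (hr : ∀ x y, r x y → c x = y) (hr' : ∀ x, QuotEq r x (c x)) :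
    IsPairing r Set.univ := by
  refine fun b _ => ⟨c b, trivial, hne b, fun q _ => ⟨fun hq => ?_, ?_⟩⟩
  · have arc_congr : ∀ x y, r x y → s(x, c x) = s(y, c y) := by
      intro x y hxy
      rw [← hr x y hxy, hc x, Sym2.eq_swap]
    have : s(q, c q) = s(b, c b) := congrArg (Quot.lift _ arc_congr) hq
    rcases Sym2.eq_iff.1 this with ⟨h, -⟩ | ⟨h, -⟩
    exacts [.inl h, .inr h]
  · rintro (rfl | rfl)
    exacts [rfl, (hr' b).symm]

theorem IsPairing.congr (h : IsPairing r Q) (hrs : ∀ x y, QuotEq s x y ↔ QuotEq r x y) :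
    IsPairing s Q := by
  simpa only [IsPairing, hrs] using h

theorem IsPairing.adjoinPair (h : IsPairing r Q) (hx : x ∈ Q) (hy : y ∈ Q) (hxy : x ≠ y) :
    IsPairing (AdjoinPair r x y) (Q \ {x, y}) := by
  intro b hb
  obtain ⟨x', hx', hx'_ne, hx'_iff⟩ := h x hx
  obtain ⟨y', hy', hy'_ne, hy'_iff⟩ := h y hy
  obtain ⟨b', hb', hb'_ne, hb'_iff⟩ := h b hb.1
  simp only [adjoinPair_iff, Set.mem_sdiff, Set.mem_insert_iff, Set.mem_singleton_iff] at hb ⊢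
  by_cases hbx : b = x'
  · exact ⟨y', by grind⟩
  by_cases hby : b = y'
  · exact ⟨x', by grind⟩
  · exact ⟨b', by grind⟩

end Pairing

namespace RibbonGraph

section States

variable {E : Type*} (ρ : Equiv.Perm (E × Bool)) (σ : E → Bool × Bool) {S T : Set E} {e : E}
  {q u : Bool × Bool} {x y : (E × Bool) × Bool}

/-- The four ends of the two segments of an edge `f`, labelled by the group `Bool × Bool`, whose
addition is the componentwise exclusive or. -/
def segEnd (f : E) (q : Bool × Bool) : (E × Bool) × Bool :=
  ((f, q.1), q.2)

/-- The arcs obtained from the rotation `ρ` by keeping the vertex corners and joining, for every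
`f ∈ S`, the four ends of the segments of `f` in two pairs that differ by `σ f`. The shifts
`(0, 1)`, `(1, 1)` and `(1, 0)` are an absent, an untwisted and a twisted edge. -/
inductive StateArc (S : Set E) : (E × Bool) × Bool → (E × Bool) × Bool → Prop
  | corner (h : E × Bool) : StateArc S (h, true) (ρ h, false)
  | band (f : E) (hf : f ∈ S) (q : Bool × Bool) : StateArc S (segEnd f q) (segEnd f (q + σ f))

/-- The number of closed curves formed by the arcs of the state `σ`. -/
noncomputable def boundaryCount : ℕ :=
  Nat.card (Quot (StateArc ρ σ Set.univ))

/-- The relation `r` with the four ends of `e` joined in the pairs `{0, q}` and `{u, u + q}`. -/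
def glueBand (r : (E × Bool) × Bool → (E × Bool) × Bool → Prop) (e : E) (q u : Bool × Bool) :
    (E × Bool) × Bool → (E × Bool) × Bool → Prop :=
  AdjoinPair (AdjoinPair r (segEnd e 0) (segEnd e q)) (segEnd e u) (segEnd e (u + q))

variable {ρ σ} {τ : E → Bool × Bool}

theorem segEnd_injective : Function.Injective (segEnd e) := by
  rintro ⟨i, s⟩ ⟨j, t⟩ h
  simp_all [segEnd]

theorem eq_zero_or_eq_or_eq_or_eq_add (hq : q ≠ 0) (hu : u ≠ 0) (huq : u ≠ q)
    (w : Bool × Bool) : w = 0 ∨ w = q ∨ w = u ∨ w = u + q := by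
  revert q u w
  decide

theorem quotEq_segEnd_add (hf : e ∈ S) (q : Bool × Bool) :
    QuotEq (StateArc ρ σ S) (segEnd e q) (segEnd e (q + σ e)) :=
  Quot.sound (.band e hf q)

theorem exists_shift_ne (q : Bool × Bool) : ∃ u : Bool × Bool, u ≠ 0 ∧ u ≠ q := by
  revert q
  decide

theorem add_eq_zero_iff_eq (q w : Bool × Bool) : q + w = 0 ↔ q = w := by
  revert q w
  decide

theorem add_self_eq_zero (q : Bool × Bool) : q + q = 0 :=
  (add_eq_zero_iff_eq q q).2 rfl

theorem StateArc.mono (hST : S ⊆ T) (hστ : ∀ f ∈ S, σ f = τ f) (hxy : StateArc ρ σ S x y) :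
    StateArc ρ τ T x y := by
  cases hxy with
  | corner h => exact .corner h
  | band f hf q => exact hστ f hf ▸ .band f (hST hf) q

theorem stateArc_congr (hστ : ∀ f ∈ S, σ f = τ f) : StateArc ρ σ S = StateArc ρ τ S := by
  ext x y
  exact ⟨.mono subset_rfl hστ, .mono subset_rfl fun f hf => (hστ f hf).symm⟩

theorem stateArc_insert_iff (hq : σ e ≠ 0) (hu : u ≠ 0) (huq : u ≠ σ e) :
    QuotEq (StateArc ρ σ (insert e S)) x y ↔ QuotEq (glueBand (StateArc ρ σ S) e (σ e) u) x y := by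
  have first_pair : QuotEq (glueBand (StateArc ρ σ S) e (σ e) u) (segEnd e 0) (segEnd e (σ e)) :=
    AdjoinPair.of_quotEq AdjoinPair.quotEq
  have second_pair :
      QuotEq (glueBand (StateArc ρ σ S) e (σ e) u) (segEnd e u) (segEnd e (u + σ e)) :=
    AdjoinPair.quotEq
  refine quotEq_congr ?_ ?_
  · rintro _ _ (h | ⟨f, rfl | hf, w⟩)
    · exact Quot.sound (.inl (.inl (.corner h)))
    · rcases eq_zero_or_eq_or_eq_or_eq_add hq hu huq w with rfl | rfl | rfl | rfl
      · rwa [zero_add]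
      · rw [add_self_eq_zero]
        exact first_pair.symm
      · exact second_pair
      · rw [add_assoc, add_self_eq_zero, add_zero]
        exact second_pair.symm
    · exact Quot.sound (.inl (.inl (.band f hf w)))
  · rintro _ _ ((h | ⟨rfl, rfl⟩) | ⟨rfl, rfl⟩)
    · exact Quot.sound (h.mono (Set.subset_insert e S) fun _ _ => rfl)
    · simpa only [zero_add] using quotEq_segEnd_add (Set.mem_insert e S) 0
    · exact quotEq_segEnd_add (Set.mem_insert e S) u

theorem isPairing_stateArc_empty : IsPairing (StateArc ρ σ ∅) Set.univ := by
  have corner (h : E × Bool) : QuotEq (StateArc ρ σ ∅) (h, true) (ρ h, false) :=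
    Quot.sound (.corner h)
  refine isPairing_univ_of_involutive
    (c := fun x => if x.2 then (ρ x.1, false) else (ρ.symm x.1, true)) ?_ ?_ ?_ ?_
  · rintro ⟨h, _ | _⟩ <;> simp
  · rintro ⟨h, _ | _⟩ <;> simp
  · rintro _ _ (h | ⟨f, ⟨⟩, w⟩)
    rfl
  · rintro ⟨h, _ | _⟩
    · simpa using (corner (ρ.symm h)).symm
    · exact corner h

theorem isPairing_stateArc_insert (hS : IsPairing (StateArc ρ σ S) {x | x.1.1 ∉ S})
    (he : e ∉ S) (hq : σ e ≠ 0) :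
    IsPairing (StateArc ρ σ (insert e S)) {x | x.1.1 ∉ insert e S} := by
  obtain ⟨u, hu, huq⟩ := exists_shift_ne (σ e)
  have hne {w w' : Bool × Bool} (h : w ≠ w') : segEnd e w ≠ segEnd e w' :=
    segEnd_injective.ne h
  have ends_eq : {x : (E × Bool) × Bool | x.1.1 ∉ insert e S} =
      ({x | x.1.1 ∉ S} \ {segEnd e 0, segEnd e (σ e)}) \ {segEnd e u, segEnd e (u + σ e)} := by
    ext ⟨⟨f, i⟩, t⟩
    have := eq_zero_or_eq_or_eq_or_eq_add hq hu huq (i, t)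
    simp only [Set.mem_sdiff, Set.mem_ofPred_eq, Set.mem_insert_iff, Set.mem_singleton_iff]
    simp only [segEnd] at *
    grind
  rw [ends_eq]
  refine IsPairing.congr (IsPairing.adjoinPair (IsPairing.adjoinPair hS he he (hne hq.symm))
    ⟨he, ?_⟩ ⟨he, ?_⟩ (hne ?_)) fun _ _ => stateArc_insert_iff hq hu huq
  · simp [hne hu, hne huq]
  · simp [segEnd_injective.eq_iff, hu, add_eq_zero_iff_eq, huq]
  · simpa using hq

theorem isPairing_stateArc [Finite E] (hσ : ∀ f ∈ S, σ f ≠ 0) :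
    IsPairing (StateArc ρ σ S) {x | x.1.1 ∉ S} := by
  induction S, S.toFinite using Set.Finite.induction_on with
  | empty => simpa using isPairing_stateArc_empty
  | insert he _ ih =>
    exact isPairing_stateArc_insert (ih fun f hf => hσ f (Set.mem_insert_of_mem _ hf)) he
      (hσ _ (Set.mem_insert _ _))

theorem exists_cut_pairing [Finite E] (hσ : ∀ f ≠ e, σ f ≠ 0) :
    ∃ p ≠ 0, (∀ q, QuotEq (StateArc ρ σ {e}ᶜ) (segEnd e q) (segEnd e (q + p))) ∧
      ∀ q, QuotEq (StateArc ρ σ {e}ᶜ) (segEnd e q) (segEnd e 0) → q = 0 ∨ q = p := by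
  have pairing := isPairing_stateArc (ρ := ρ) (S := {e}ᶜ) hσ
  have partner (q : Bool × Bool) : ∃ q' ≠ q, ∀ w,
      QuotEq (StateArc ρ σ {e}ᶜ) (segEnd e w) (segEnd e q) ↔ w = q ∨ w = q' := by
    obtain ⟨⟨⟨f, i⟩, t⟩, hf, hne, hiff⟩ := pairing (segEnd e q) (by simp [segEnd])
    obtain rfl : f = e := by simpa using hf
    refine ⟨(i, t), fun h => hne (h ▸ rfl), fun w => ?_⟩
    exact (hiff _ (by simp [segEnd])).trans
      (or_congr segEnd_injective.eq_iff (segEnd_injective (e := f).eq_iff (b := (i, t))))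
  obtain ⟨p, hp, hp_iff⟩ := partner 0
  refine ⟨p, hp, fun q => ?_, fun q => (hp_iff q).1⟩
  have hp0 : QuotEq (StateArc ρ σ {e}ᶜ) (segEnd e p) (segEnd e 0) := (hp_iff p).2 (.inr rfl)
  by_cases hq0 : q = 0
  · rw [hq0, zero_add]
    exact hp0.symm
  by_cases hqp : q = p
  · rwa [hqp, add_self_eq_zero]
  have not_zero : ¬ QuotEq (StateArc ρ σ {e}ᶜ) (segEnd e q) (segEnd e 0) := by
    simp [hp_iff, hq0, hqp]
  obtain ⟨q', hq', hq'_iff⟩ := partner q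
  have hq'q : QuotEq (StateArc ρ σ {e}ᶜ) (segEnd e q') (segEnd e q) := (hq'_iff q').2 (.inr rfl)
  rcases eq_zero_or_eq_or_eq_or_eq_add hp hq0 hqp q' with rfl | rfl | rfl | rfl
  exacts [(not_zero hq'q.symm).elim, (not_zero (hq'q.symm.trans hp0)).elim, (hq' rfl).elim,
    hq'q.symm]

theorem boundaryCount_eq_card_glueBand (hq : σ e ≠ 0) (hu : u ≠ 0) (huq : u ≠ σ e) :
    boundaryCount ρ σ = Nat.card (Quot (glueBand (StateArc ρ σ {e}ᶜ) e (σ e) u)) := by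
  have insert_compl : insert e ({e}ᶜ : Set E) = Set.univ := Set.union_compl_self {e}
  rw [boundaryCount, ← insert_compl]
  exact card_quot_eq_of_quotEq
    (fun x y h => (stateArc_insert_iff hq hu huq).1 (Quot.sound h))
    (fun x y h => (stateArc_insert_iff hq hu huq).2 (Quot.sound h))

/-- Of the three ways to fill in the edge `e`, the two that do not continue the outer pairing `p`
of its four ends merge two curves. -/
theorem exists_boundaryCount_eq [Finite E] (hσ : ∀ f ≠ e, σ f ≠ 0) :
    ∃ p ≠ 0, QuotEq (StateArc ρ σ {e}ᶜ) (segEnd e 0) (segEnd e p) ∧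
      ∀ τ : E → Bool × Bool, (∀ f ≠ e, τ f = σ f) → τ e ≠ 0 →
        boundaryCount ρ τ + (if τ e = p then 0 else 1) = Nat.card (Quot (StateArc ρ σ {e}ᶜ)) := by
  obtain ⟨p, hp, hpair, hp_only⟩ := exists_cut_pairing (ρ := ρ) hσ
  refine ⟨p, hp, by simpa only [zero_add] using hpair 0, fun τ hτ hq => ?_⟩
  have count_eq {u : Bool × Bool} (hu : u ≠ 0) (huq : u ≠ τ e) :
      boundaryCount ρ τ = Nat.card (Quot (glueBand (StateArc ρ σ {e}ᶜ) e (τ e) u)) :=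
    stateArc_congr hτ ▸ boundaryCount_eq_card_glueBand hq hu huq
  split_ifs with hqp
  · obtain ⟨u, hu, huq⟩ := exists_shift_ne (τ e)
    rw [count_eq hu huq, glueBand, card_adjoinPair_of_quotEq, card_adjoinPair_of_quotEq,
      add_zero]
    · simpa only [zero_add, hqp] using hpair 0
    · exact AdjoinPair.of_quotEq (hqp ▸ hpair u)
  · have hp_join : QuotEq (AdjoinPair (StateArc ρ σ {e}ᶜ) (segEnd e 0) (segEnd e (τ e)))
        (segEnd e p) (segEnd e (p + τ e)) := by
      rw [add_comm]
      exact adjoinPair_iff.2 (.inr (.inl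
        ⟨by simpa only [zero_add] using (hpair 0).symm, (hpair (τ e)).symm⟩))
    rw [count_eq hp (Ne.symm hqp), glueBand, card_adjoinPair_of_quotEq hp_join,
      card_adjoinPair_of_not_quotEq]
    exact fun h => (hp_only _ h.symm).elim hq hqp

end States

end RibbonGraph

namespace RibbonGraph

section Components

variable {V E : Type*}

/-- Half-edges are identified along the rotation `ρ` and along the edges of `A`: the classes are
the connected components that carry a half-edge. -/
inductive HalfEdgeArc (ρ : Equiv.Perm (E × Bool)) (A : Set E) : E × Bool → E × Bool → Prop
  | rot (h : E × Bool) : HalfEdgeArc ρ A h (ρ h)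
  | edge (f : E) (hf : f ∈ A) : HalfEdgeArc ρ A (f, false) (f, true)

variable (G : RibbonGraph V E) {A B S : Set E} {e : E} {h h' : E × Bool}

/-- The number of vertices without half-edges. -/
noncomputable def numIsolated : ℕ :=
  Nat.card {v : V // ∀ h, G.vert h ≠ v}

open Classical in
/-- The state of the rotation system `G.rot` that describes the spanning ribbon subgraph
`(V, A)`. -/
noncomputable def state (A : Set E) (f : E) : Bool × Bool :=
  if f ∈ A then (true, !G.twisted f) else (false, true)

variable {G}

theorem state_of_mem {f : E} (hf : f ∈ A) : G.state A f = (true, !G.twisted f) :=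
  if_pos hf

theorem state_of_notMem {f : E} (hf : f ∉ A) : G.state A f = (false, true) :=
  if_neg hf

theorem state_ne_zero (f : E) : G.state A f ≠ 0 := by
  unfold state
  split_ifs <;> simp [Prod.ext_iff]

theorem state_insert_of_ne {f : E} (hf : f ≠ e) : G.state (insert e A) f = G.state A f := by
  by_cases hfA : f ∈ A
  · rw [state_of_mem hfA, state_of_mem (Set.mem_insert_of_mem e hfA)]
  · rw [state_of_notMem hfA, state_of_notMem (by simp [hf, hfA])]

theorem quotEq_side {f : E} (hfA : f ∈ A) (hfS : f ∈ S) (s : Bool) :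
    QuotEq (StateArc G.rot (G.state A) S) ((f, false), s) ((f, true), xor s (!G.twisted f)) := by
  have := quotEq_segEnd_add (ρ := G.rot) (σ := G.state A) hfS (false, s)
  rwa [state_of_mem hfA] at this

theorem quotEq_free (hhA : h.1 ∉ A) (hhS : h.1 ∈ S) :
    QuotEq (StateArc G.rot (G.state A) S) (h, false) (h, true) := by
  obtain ⟨f, i⟩ := h
  have := quotEq_segEnd_add (ρ := G.rot) (σ := G.state A) hhS (i, false)
  rw [state_of_notMem hhA] at this
  cases i <;> exact this

theorem f_eq_boundaryCount_add (A : Set E) :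
    G.f A = boundaryCount G.rot (G.state A) + G.numIsolated := by
  refine congrArg (· + G.numIsolated) (card_quot_eq_of_quotEq ?_ ?_)
  · rintro _ _ (h | ⟨h, hA⟩ | ⟨f, hA, s⟩)
    · exact Quot.sound (.corner h)
    · exact quotEq_free hA trivial
    · exact quotEq_side hA (Set.mem_univ f) s
  · rintro _ _ (h | ⟨f, -, ⟨i, s⟩⟩)
    · exact Quot.sound (.corner h)
    by_cases hf : f ∈ A
    · have side (s : Bool) :
          QuotEq (G.BoundaryArc A) ((f, false), s) ((f, true), xor s (!G.twisted f)) :=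
        Quot.sound (.side f hf s)
      rw [state_of_mem hf]
      cases i
      · exact side s
      · have := (side (xor s (!G.twisted f))).symm
        rwa [Bool.xor_assoc, Bool.xor_self, Bool.xor_false] at this
    · have free : QuotEq (G.BoundaryArc A) ((f, i), false) ((f, i), true) :=
        Quot.sound (.free (f, i) hf)
      rw [state_of_notMem hf]
      cases i <;> cases s
      exacts [free, free.symm, free, free.symm]

theorem vert_rot (h : E × Bool) : G.vert (G.rot h) = G.vert h :=
  ((G.vert_eq_iff _ _).2 ⟨1, by simp⟩).symm

theorem quotEq_of_sameCycle {ρ : Equiv.Perm (E × Bool)} (hh : ρ.SameCycle h h') :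
    QuotEq (HalfEdgeArc ρ A) h h' :=
  apply_eq_of_sameCycle (fun x => (Quot.sound (.rot x)).symm) hh

open Classical in
/-- The component of the vertex `v`: the class of the half-edges on it, or `v` itself if there are
none. -/
noncomputable def vertexClass (G : RibbonGraph V E) (A : Set E) (v : V) :
    Quot (HalfEdgeArc G.rot A) ⊕ {v : V // ∀ h, G.vert h ≠ v} :=
  if hv : ∃ h, G.vert h = v then .inl (Quot.mk _ hv.choose) else .inr ⟨v, not_exists.1 hv⟩

theorem vertexClass_vert (h : E × Bool) : G.vertexClass A (G.vert h) = .inl (Quot.mk _ h) := by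
  have hv : ∃ h', G.vert h' = G.vert h := ⟨h, rfl⟩
  rw [vertexClass, dif_pos hv]
  exact congrArg Sum.inl (quotEq_of_sameCycle ((G.vert_eq_iff _ _).1 hv.choose_spec))

theorem vertexClass_eq_of_joined {u v : V} (huv : G.Joined A u v) :
    G.vertexClass A u = G.vertexClass A v := by
  obtain ⟨f, hf, rfl, rfl⟩ := huv
  rw [vertexClass_vert, vertexClass_vert]
  exact congrArg Sum.inl (Quot.sound (.edge f hf))

theorem quotEq_vert_of_halfEdgeArc (hh : HalfEdgeArc G.rot A h h') :
    QuotEq (G.Joined A) (G.vert h) (G.vert h') := by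
  cases hh with
  | rot h => rw [vert_rot]
  | edge f hf => exact Quot.sound ⟨f, hf, rfl, rfl⟩

theorem quotEq_vert_iff :
    QuotEq (G.Joined A) (G.vert h) (G.vert h') ↔ QuotEq (HalfEdgeArc G.rot A) h h' := by
  refine ⟨fun hh => ?_, QuotEq.map G.vert fun _ _ => quotEq_vert_of_halfEdgeArc⟩
  have := congrArg (Quot.lift (G.vertexClass A) fun _ _ => vertexClass_eq_of_joined) hh
  exact Sum.inl_injective ((vertexClass_vert h).symm.trans (this.trans (vertexClass_vert h')))

theorem quotEq_joined_empty_iff {v v' : V} : QuotEq (G.Joined ∅) v v' ↔ v = v' :=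
  ⟨congrArg (Quot.lift id fun _ _ ⟨_, hf, _⟩ => hf.elim), congrArg _⟩

theorem joined_insert (A : Set E) (e : E) :
    G.Joined (insert e A) = AdjoinPair (G.Joined A) (G.vert (e, false)) (G.vert (e, true)) := by
  ext u v
  constructor
  · rintro ⟨f, rfl | hf, rfl, rfl⟩
    exacts [.inr ⟨rfl, rfl⟩, .inl ⟨f, hf, rfl, rfl⟩]
  · rintro (⟨f, hf, hfuv⟩ | ⟨rfl, rfl⟩)
    exacts [⟨f, .inr hf, hfuv⟩, ⟨e, .inl rfl, rfl, rfl⟩]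

theorem quotEq_joined_singleton_iff {v v' : V} : QuotEq (G.Joined {e}) v v' ↔
    v = v' ∨ (v = G.vert (e, false) ∧ v' = G.vert (e, true)) ∨
      (v = G.vert (e, true) ∧ v' = G.vert (e, false)) := by
  rw [← LawfulSingleton.insert_empty_eq e, joined_insert, adjoinPair_iff]
  simp only [quotEq_joined_empty_iff]

theorem k_insert_of_quotEq (he : QuotEq (G.Joined A) (G.vert (e, false)) (G.vert (e, true))) :
    G.k (insert e A) = G.k A := by
  rw [k, joined_insert, card_adjoinPair_of_quotEq he, k]

theorem k_empty : G.k ∅ = Nat.card V :=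
  Nat.card_congr
    { toFun := Quot.lift id fun _ _ ⟨_, hf, _⟩ => hf.elim
      invFun := Quot.mk _
      left_inv := by rintro ⟨v⟩; rfl
      right_inv := fun _ => rfl }

theorem quotEq_fst_of_stateArc {S : Set E} {x y : (E × Bool) × Bool}
    (hxy : StateArc G.rot (G.state A) S x y) : QuotEq (HalfEdgeArc G.rot A) x.1 y.1 := by
  obtain h | ⟨f, -, q⟩ := hxy
  · exact Quot.sound (.rot h)
  · by_cases hf : f ∈ A
    · have edge : QuotEq (HalfEdgeArc G.rot A) (f, false) (f, true) := Quot.sound (.edge f hf)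
      rw [state_of_mem hf]
      obtain ⟨_ | _, s⟩ := q
      exacts [edge, edge.symm]
    · rw [state_of_notMem hf]
      obtain ⟨_ | _, s⟩ := q <;> rfl

theorem f_insert_add_one [Finite E] (heA : e ∉ A)
    (he : ¬ QuotEq (G.Joined A) (G.vert (e, false)) (G.vert (e, true))) :
    G.f (insert e A) + 1 = G.f A := by
  obtain ⟨p, hp, hpair, hcount⟩ := exists_boundaryCount_eq (ρ := G.rot) (σ := G.state A) (e := e)
    fun f _ => state_ne_zero f
  have hp_fst : p = (false, true) := by
    have : p.1 = false := by
      by_contra hp1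
      refine he (quotEq_vert_iff.2 ?_)
      have := QuotEq.map Prod.fst (fun _ _ => quotEq_fst_of_stateArc) hpair
      rwa [segEnd, segEnd, Bool.eq_true_of_not_eq_false hp1] at this
    obtain ⟨_ | _, _ | _⟩ := p <;> simp_all
  have hA := hcount (G.state A) (fun _ _ => rfl) (state_ne_zero e)
  have hinsert := hcount (G.state (insert e A)) (fun f hf => state_insert_of_ne hf)
    (state_ne_zero e)
  rw [state_of_notMem heA, if_pos hp_fst.symm] at hA
  rw [state_of_mem (Set.mem_insert e A), if_neg (by simp [hp_fst])] at hinsert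
  rw [f_eq_boundaryCount_add, f_eq_boundaryCount_add]
  omega

variable [Finite V]

theorem k_anti (hAB : A ⊆ B) : G.k B ≤ G.k A :=
  card_quot_le_of_surjective Function.surjective_id
    fun _ _ ⟨f, hf, hfuv⟩ => Quot.sound ⟨f, hAB hf, hfuv⟩

theorem k_insert_add_one (he : ¬ QuotEq (G.Joined A) (G.vert (e, false)) (G.vert (e, true))) :
    G.k (insert e A) + 1 = G.k A := by
  rw [k, joined_insert, card_adjoinPair_of_not_quotEq he, k]

theorem isBridge_iff :
    G.IsBridge e ↔ ¬ QuotEq (G.Joined {e}ᶜ) (G.vert (e, false)) (G.vert (e, true)) := by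
  rw [IsBridge, ← show insert e ({e}ᶜ : Set E) = Set.univ from Set.union_compl_self {e}]
  by_cases he : QuotEq (G.Joined {e}ᶜ) (G.vert (e, false)) (G.vert (e, true))
  · simp [k_insert_of_quotEq he, he]
  · simp [← k_insert_add_one he, he]

variable [Finite E]

theorem k_eq_card_add (A : Set E) :
    G.k A = Nat.card (Quot (HalfEdgeArc G.rot A)) + G.numIsolated := by
  rw [numIsolated, ← Nat.card_sum, k]
  refine Nat.card_congr
    { toFun := Quot.lift (G.vertexClass A) fun _ _ => vertexClass_eq_of_joined
      invFun := Sum.elim (Quot.lift (fun h => Quot.mk _ (G.vert h))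
        fun _ _ => quotEq_vert_of_halfEdgeArc) fun v => Quot.mk _ v.1
      left_inv := ?_
      right_inv := ?_ }
  · rintro ⟨v⟩
    by_cases hv : ∃ h, G.vert h = v
    · obtain ⟨h, rfl⟩ := hv
      simp only [vertexClass_vert, Sum.elim_inl]
    · simp only [vertexClass, dif_neg hv, Sum.elim_inr]
  · rintro (⟨⟨h⟩⟩ | ⟨v, hv⟩)
    · exact vertexClass_vert h
    · exact dif_neg (not_exists.2 hv)

theorem k_le_f (A : Set E) : G.k A ≤ G.f A := by
  rw [k_eq_card_add, f_eq_boundaryCount_add]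
  exact Nat.add_le_add_right (card_quot_le_of_surjective Prod.fst_surjective
    fun _ _ => quotEq_fst_of_stateArc) _

theorem f_empty : G.f ∅ = G.k ∅ := by
  rw [k_eq_card_add, f_eq_boundaryCount_add]
  have segment (h : E × Bool) :
      QuotEq (StateArc G.rot (G.state ∅) Set.univ) (h, false) (h, true) :=
    quotEq_free (Set.notMem_empty h.1) trivial
  refine congrArg (· + G.numIsolated) (card_quot_congr Prod.fst (·, false)
    (fun _ _ => quotEq_fst_of_stateArc) ?_ ?_ fun _ => rfl)
  · rintro _ _ (h | ⟨f, ⟨⟩⟩)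
    exact (segment _).trans (Quot.sound (.corner _))
  · rintro ⟨h, _ | _⟩
    exacts [rfl, segment h]

end Components

end RibbonGraph

namespace RibbonGraph

section Forests

variable {V E : Type*} {G : RibbonGraph V E} {A T F : Set E} {e : E}

variable (G) in
/-- The edge set `T` contains no cycle: each of its edges reduces the number of components. -/
def IsForest (T : Set E) : Prop :=
  G.k T + T.ncard = Nat.card V

theorem isForest_empty : G.IsForest ∅ := by
  rw [IsForest, k_empty, Set.ncard_empty, add_zero]

variable [Finite V] [Finite E]

theorem card_le_k_add_ncard (A : Set E) : Nat.card V ≤ G.k A + A.ncard := by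
  induction A, A.toFinite using Set.Finite.induction_on with
  | empty => rw [k_empty, Set.ncard_empty, add_zero]
  | @insert e A he _ ih =>
    rw [Set.ncard_insert_of_notMem he]
    by_cases h : QuotEq (G.Joined A) (G.vert (e, false)) (G.vert (e, true))
    · rw [k_insert_of_quotEq h]
      omega
    · have := k_insert_add_one h
      omega

theorem isForest_insert_iff (he : e ∉ T) : G.IsForest (insert e T) ↔
    G.IsForest T ∧ ¬ QuotEq (G.Joined T) (G.vert (e, false)) (G.vert (e, true)) := by
  rw [IsForest, IsForest, Set.ncard_insert_of_notMem he]
  have := card_le_k_add_ncard (G := G) T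
  by_cases h : QuotEq (G.Joined T) (G.vert (e, false)) (G.vert (e, true))
  · simp only [k_insert_of_quotEq h, eq_true h, not_true, and_false, iff_false]
    omega
  · rw [← k_insert_add_one h]
    simp only [h, not_false_eq_true, and_true]
    omega

theorem IsForest.exists_spanning (hT : G.IsForest T) (hTA : T ⊆ A) :
    ∃ T', T ⊆ T' ∧ T' ⊆ A ∧ G.IsForest T' ∧ G.k T' = G.k A := by
  obtain ⟨T', hTT', ⟨hT'A, hT'⟩, hmax⟩ :=
    (Set.toFinite {T' | T' ⊆ A ∧ G.IsForest T'}).exists_le_maximal ⟨hTA, hT⟩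
  refine ⟨T', hTT', hT'A, hT', card_quot_eq_of_quotEq
    (fun _ _ ⟨f, hf, hfuv⟩ => Quot.sound ⟨f, hT'A hf, hfuv⟩) ?_⟩
  rintro _ _ ⟨f, hf, rfl, rfl⟩
  by_contra hcon
  have hfT' : f ∉ T' := fun hfT' => hcon (Quot.sound ⟨f, hfT', rfl, rfl⟩)
  exact hfT' (hmax ⟨Set.insert_subset hf hT'A, (isForest_insert_iff hfT').2 ⟨hT', hcon⟩⟩
    (Set.subset_insert f T') (Set.mem_insert f T'))

theorem IsForest.f_eq_k (hT : G.IsForest T) : G.f T = G.k T := by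
  induction T, T.toFinite using Set.Finite.induction_on with
  | empty => exact f_empty
  | @insert e T he _ ih =>
    obtain ⟨hT', hcon⟩ := (isForest_insert_iff he).1 hT
    have hf := f_insert_add_one he hcon
    have hk := k_insert_add_one hcon
    have := ih hT'
    omega

theorem IsLoop.notMem_of_isForest (he : G.IsLoop e) (hT : G.IsForest T) : e ∉ T := by
  intro heT
  rw [← Set.insert_sdiff_self_of_mem heT, isForest_insert_iff (by simp)] at hT
  exact hT.2 (congrArg _ he)

theorem k_eq_of_feasible (hF : G.D.Feasible F) : G.k F = G.k Set.univ :=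
  le_antisymm ((k_le_f F).trans (le_of_eq hF)) (k_anti (Set.subset_univ F))

theorem IsForest.feasible_iff (hT : G.IsForest T) : G.D.Feasible T ↔ G.k T = G.k Set.univ :=
  hT.f_eq_k ▸ Iff.rfl

theorem exists_spanning_forest (G : RibbonGraph V E) (A : Set E) :
    ∃ T ⊆ A, G.IsForest T ∧ G.k T = G.k A :=
  let ⟨T, _, hTA, hT⟩ := (isForest_empty (G := G)).exists_spanning (Set.empty_subset A)
  ⟨T, hTA, hT⟩

theorem lower_feasible_iff : G.D.lower.Feasible F ↔ G.IsForest F ∧ G.k F = G.k Set.univ := by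
  constructor
  · rintro ⟨hF, hmin⟩
    obtain ⟨T, -, hT, hTk⟩ := exists_spanning_forest G Set.univ
    have hTF := hmin T (hT.feasible_iff.2 hTk)
    have hk := k_eq_of_feasible hF
    have := card_le_k_add_ncard (G := G) F
    unfold IsForest at *
    exact ⟨by omega, hk⟩
  · rintro ⟨hF, hk⟩
    refine ⟨hF.feasible_iff.2 hk, fun F' hF' => ?_⟩
    have hk' := k_eq_of_feasible hF'
    have := card_le_k_add_ncard (G := G) F'
    unfold IsForest at hF
    omega

theorem isLoop_iff_isRibbonLoop : G.IsLoop e ↔ G.D.IsRibbonLoop e := by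
  refine ⟨fun he F hF => he.notMem_of_isForest (lower_feasible_iff.1 hF).1, fun he => ?_⟩
  by_contra hl
  have hforest : G.IsForest (insert e ∅) := by
    refine (isForest_insert_iff (Set.notMem_empty e)).2 ⟨isForest_empty, ?_⟩
    rwa [quotEq_joined_empty_iff]
  obtain ⟨T, heT, -, hT⟩ := hforest.exists_spanning (Set.subset_univ _)
  exact he T (lower_feasible_iff.2 hT) (heT (Set.mem_insert e ∅))

theorem isColoop_iff_isBridge : G.D.IsColoop e ↔ G.IsBridge e := by
  constructor
  · intro he
    by_contra hb
    have hk : G.k {e}ᶜ = G.k Set.univ := le_antisymm (not_lt.1 hb) (k_anti (Set.subset_univ _))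
    obtain ⟨T, hTe, hT, hTk⟩ := exists_spanning_forest G {e}ᶜ
    exact hTe (he T (hT.feasible_iff.2 (hTk.trans hk))) rfl
  · intro hb F hF
    by_contra heF
    have hk : G.k {e}ᶜ ≤ G.k F := k_anti (Set.subset_compl_singleton_iff.2 heF)
    rw [k_eq_of_feasible hF] at hk
    exact hk.not_gt hb

end Forests

end RibbonGraph

section CycleSplitting

variable {X : Type*} {ρ : Equiv.Perm X} {a x : X} {i j m : ℕ}

theorem iterate_inj_of_lt_minimalPeriod (hi : i < Function.minimalPeriod ρ a)
    (hj : j < Function.minimalPeriod ρ a) : ρ^[i] a = ρ^[j] a ↔ i = j :=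
  Function.iterate_injOn_Iio_minimalPeriod.eq_iff (Set.mem_Iio.2 hi) (Set.mem_Iio.2 hj)

theorem exists_iterate_eq_of_sameCycle [Finite X] (h : ρ.SameCycle a x) :
    ∃ i < Function.minimalPeriod ρ a, ρ^[i] a = x := by
  obtain ⟨n, -, hn⟩ := h.exists_pow_eq'
  refine ⟨n % Function.minimalPeriod ρ a, Nat.mod_lt _ ?_, ?_⟩
  · exact Function.minimalPeriod_pos_of_mem_periodicPts (ρ.injective.mem_periodicPts a)
  · rw [Function.iterate_mod_minimalPeriod_eq, Equiv.Perm.iterate_eq_pow, hn]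

variable [DecidableEq X]

theorem swap_mul_apply_iterate (hm : m < Function.minimalPeriod ρ a) (hi : i + 1 < m) :
    (Equiv.swap a (ρ^[m] a) * ρ) (ρ^[i] a) = ρ^[i + 1] a := by
  rw [Equiv.Perm.mul_apply, ← Function.iterate_succ_apply' ρ i a, Equiv.swap_apply_of_ne_of_ne]
  · rw [Ne, ← Function.iterate_zero_apply ρ a, ← Function.iterate_add_apply,
      iterate_inj_of_lt_minimalPeriod (by omega) (by omega)]
    omega
  · rw [Ne, iterate_inj_of_lt_minimalPeriod (by omega) hm]
    omega

theorem swap_mul_apply_iterate_of_eq (hi : i + 1 = m) :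
    (Equiv.swap a (ρ^[m] a) * ρ) (ρ^[i] a) = a := by
  rw [Equiv.Perm.mul_apply, ← Function.iterate_succ_apply' ρ i a, Nat.succ_eq_add_one, hi,
    Equiv.swap_apply_right]

theorem sameCycle_swap_mul_iterate_iff [Finite X] (hm0 : 0 < m)
    (hm : m < Function.minimalPeriod ρ a) (hi : i < Function.minimalPeriod ρ a) :
    (Equiv.swap a (ρ^[m] a) * ρ).SameCycle a (ρ^[i] a) ↔ i < m := by
  constructor
  · intro h
    obtain ⟨n, -, hn⟩ := exists_iterate_eq_of_sameCycle h
    have orbit (n : ℕ) : ∃ j < m, (Equiv.swap a (ρ^[m] a) * ρ)^[n] a = ρ^[j] a := by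
      induction n with
      | zero => exact ⟨0, hm0, rfl⟩
      | succ n ih =>
        obtain ⟨j, hj, hnj⟩ := ih
        rw [Function.iterate_succ_apply', hnj]
        rcases eq_or_lt_of_le (Nat.succ_le_of_lt hj) with hjm | hjm
        · exact ⟨0, hm0, swap_mul_apply_iterate_of_eq hjm⟩
        · exact ⟨j + 1, hjm, swap_mul_apply_iterate hm hjm⟩
    obtain ⟨j, hj, hnj⟩ := orbit n
    rw [hn, iterate_inj_of_lt_minimalPeriod hi (by omega)] at hnj
    omega
  · intro him
    induction i with
    | zero => exact Equiv.Perm.SameCycle.refl ..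
    | succ i ih =>
      rw [← swap_mul_apply_iterate hm him, Equiv.Perm.sameCycle_apply_right]
      exact ih (by omega) (by omega)

end CycleSplitting

namespace RibbonGraph

section SwapStates

variable {E : Type*} {ρ : Equiv.Perm (E × Bool)} {σ τ : E → Bool × Bool} {e : E}

/-- The effect on the state of an edge of exchanging the first ends of its two segments: an absent
and an untwisted edge swap places, and a twisted edge remains twisted. -/
def shear (q : Bool × Bool) : Bool × Bool :=
  (q.1 + q.2, q.2)

theorem shear_shear (q : Bool × Bool) : shear (shear q) = q := by
  revert q
  decide

variable [DecidableEq E]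

/-- Exchanges the first ends of the two segments of `e`, the points at which a corner arc enters a
segment; this turns the corners of `ρ` into those of `swap (e, false) (e, true) * ρ`. -/
def exchangeFirstEnds (e : E) (x : (E × Bool) × Bool) : (E × Bool) × Bool :=
  if x.2 then x else (Equiv.swap (e, false) (e, true) x.1, x.2)

theorem exchangeFirstEnds_exchangeFirstEnds (x : (E × Bool) × Bool) :
    exchangeFirstEnds e (exchangeFirstEnds e x) = x := by
  obtain ⟨h, _ | _⟩ := x <;> simp [exchangeFirstEnds]

theorem exchangeFirstEnds_segEnd_of_ne {f : E} (hf : f ≠ e) (q : Bool × Bool) :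
    exchangeFirstEnds e (segEnd f q) = segEnd f q := by
  obtain ⟨i, _ | _⟩ := q
  · exact congrArg (·, false)
      (Equiv.swap_apply_of_ne_of_ne (by simp [segEnd, hf]) (by simp [segEnd, hf]))
  · rfl

theorem exchangeFirstEnds_segEnd_self (q : Bool × Bool) :
    exchangeFirstEnds e (segEnd e q) = segEnd e (q.1 + q.2 + true, q.2) := by
  obtain ⟨_ | _, _ | _⟩ := q <;> simp [exchangeFirstEnds, segEnd] <;> rfl

theorem stateArc_exchangeFirstEnds (hτ : ∀ f ≠ e, τ f = σ f) (he : τ e = shear (σ e))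
    {x y : (E × Bool) × Bool} (hxy : StateArc ρ σ Set.univ x y) :
    StateArc (Equiv.swap (e, false) (e, true) * ρ) τ Set.univ
      (exchangeFirstEnds e x) (exchangeFirstEnds e y) := by
  obtain h | ⟨f, -, q⟩ := hxy
  · exact .corner h
  by_cases hf : f = e
  · subst hf
    rw [exchangeFirstEnds_segEnd_self, exchangeFirstEnds_segEnd_self]
    have : (((q + σ f).1 + (q + σ f).2 + true, (q + σ f).2) : Bool × Bool) =
        (q.1 + q.2 + true, q.2) + τ f := by
      rw [he]
      generalize σ f = w
      revert q w
      decide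
    rw [this]
    exact .band f (Set.mem_univ f) _
  · rw [exchangeFirstEnds_segEnd_of_ne hf, exchangeFirstEnds_segEnd_of_ne hf, ← hτ f hf]
    exact .band f (Set.mem_univ f) q

theorem boundaryCount_swap_mul (hτ : ∀ f ≠ e, τ f = σ f) (he : τ e = shear (σ e)) :
    boundaryCount (Equiv.swap (e, false) (e, true) * ρ) τ = boundaryCount ρ σ := by
  refine (card_quot_congr (exchangeFirstEnds e) (exchangeFirstEnds e)
    (fun _ _ hxy => Quot.sound (stateArc_exchangeFirstEnds hτ he hxy))
    (fun _ _ hxy => Quot.sound ?_)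
    (fun x => congrArg _ (exchangeFirstEnds_exchangeFirstEnds x))
    (fun x => congrArg _ (exchangeFirstEnds_exchangeFirstEnds x))).symm
  have := stateArc_exchangeFirstEnds (fun f hf => (hτ f hf).symm)
    (by rw [he, shear_shear] : σ e = shear (τ e)) hxy
  rwa [← mul_assoc, Equiv.swap_mul_self, one_mul] at this

end SwapStates

end RibbonGraph

namespace SetSystem

variable {E : Type*} {D : SetSystem E} {A : Set E} {e : E}

theorem twist_singleton_feasible_iff : (D.twist {e}).Feasible A ↔ D.Feasible (symmDiff A {e}) := by
  constructor
  · rintro ⟨X, hX, rfl⟩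
    rwa [symmDiff_comm, symmDiff_symmDiff_cancel_left]
  · exact fun h => ⟨_, h, by rw [symmDiff_comm, symmDiff_symmDiff_cancel_right]⟩

theorem symmDiff_singleton_of_notMem (he : e ∉ A) : symmDiff A {e} = insert e A := by
  rw [Set.symmDiff_def, Set.sdiff_singleton_eq_self he, Set.union_sdiff_self, Set.union_singleton]

theorem symmDiff_singleton_insert (he : e ∉ A) : symmDiff (insert e A) {e} = A := by
  rw [← symmDiff_singleton_of_notMem he, symmDiff_symmDiff_cancel_right]

theorem forall_iff_forall_notMem {P : Set E → Prop} :
    (∀ A, P A) ↔ ∀ A, e ∉ A → P A ∧ P (insert e A) := by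
  refine ⟨fun h A _ => ⟨h A, h _⟩, fun h A => ?_⟩
  by_cases he : e ∈ A
  · rw [← Set.insert_sdiff_self_of_mem he]
    exact (h (A \ {e}) (by simp)).2
  · exact (h A he).1

end SetSystem

namespace RibbonGraph

section PartialDual

variable {V E : Type*} [DecidableEq E] (G : RibbonGraph V E) {A : Set E} {e : E} {h h' : E × Bool}

/-- The partial dual at `e` of the ribbon graph obtained from `G` by removing the half-twist of `e`,
if there is one. The vertices without half-edges are kept, and the other vertices are the cycles of
the new rotation. -/
def dualAt (e : E) : RibbonGraph
    (Quotient (Equiv.Perm.SameCycle.setoid (Equiv.swap (e, false) (e, true) * G.rot)) ⊕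
      {v : V // ∀ h, G.vert h ≠ v}) E where
  vert h := .inl (Quotient.mk _ h)
  rot := Equiv.swap (e, false) (e, true) * G.rot
  vert_eq_iff _ _ := Sum.inl_injective.eq_iff.trans Quotient.eq
  twisted := Function.update G.twisted e false

variable {G}

theorem numIsolated_dualAt : (G.dualAt e).numIsolated = G.numIsolated := by
  refine (Nat.card_eq_of_bijective (fun v => ⟨.inr v, fun _ => Sum.inl_ne_inr⟩) ⟨?_, ?_⟩).symm
  · intro v v' hvv'
    exact Sum.inr_injective (Subtype.ext_iff.1 hvv')
  · rintro ⟨⟨⟨h⟩⟩ | v, hv⟩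
    exacts [(hv h rfl).elim, ⟨v, rfl⟩]

theorem state_dualAt_of_ne {f : E} (hf : f ≠ e) : (G.dualAt e).state A f = G.state A f := by
  simp only [state, dualAt, Function.update_of_ne hf]

theorem f_dualAt {σ : E → Bool × Bool} (hσ : ∀ f ≠ e, σ f = G.state A f)
    (he : (G.dualAt e).state A e = shear (σ e)) :
    (G.dualAt e).f A = boundaryCount G.rot σ + G.numIsolated := by
  rw [f_eq_boundaryCount_add, numIsolated_dualAt]
  exact congrArg (· + G.numIsolated)
    (boundaryCount_swap_mul (fun f hf => (state_dualAt_of_ne hf).trans (hσ f hf).symm) he)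

theorem state_dualAt_insert : (G.dualAt e).state (insert e A) e = (true, true) := by
  simp only [state_of_mem (Set.mem_insert e A), dualAt, Function.update_self, Bool.not_false]

theorem f_dualAt_insert (he : e ∉ A) : (G.dualAt e).f (insert e A) = G.f A := by
  rw [f_eq_boundaryCount_add A]
  refine f_dualAt (fun f hf => (state_insert_of_ne hf).symm) ?_
  rw [state_dualAt_insert, state_of_notMem he]
  rfl

theorem f_dualAt_of_notMem (ht : G.twisted e = false) (he : e ∉ A) :
    (G.dualAt e).f A = G.f (insert e A) := by
  rw [f_eq_boundaryCount_add (insert e A)]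
  refine f_dualAt (fun f hf => state_insert_of_ne hf) ?_
  rw [state_of_notMem he, state_of_mem (Set.mem_insert e A), ht]
  rfl

theorem quotEq_swap_mul {ρ : Equiv.Perm (E × Bool)} (he : e ∈ A) (hh : HalfEdgeArc ρ A h h') :
    QuotEq (HalfEdgeArc (Equiv.swap (e, false) (e, true) * ρ) A) h h' := by
  set ρ' := Equiv.swap (e, false) (e, true) * ρ
  have ends : QuotEq (HalfEdgeArc ρ' A) (e, false) (e, true) := Quot.sound (.edge e he)
  have swap_eq (x : E × Bool) :
      QuotEq (HalfEdgeArc ρ' A) (Equiv.swap (e, false) (e, true) x) x := by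
    rw [Equiv.swap_apply_def]
    split_ifs with h₀ h₁
    exacts [h₀ ▸ ends.symm, h₁ ▸ ends, rfl]
  cases hh with
  | rot h => exact (Quot.sound (.rot h)).trans (swap_eq _)
  | edge f hf => exact Quot.sound (.edge f hf)

theorem quotEq_halfEdgeArc_dualAt_iff (he : e ∈ A) :
    QuotEq (HalfEdgeArc (G.dualAt e).rot A) h h' ↔ QuotEq (HalfEdgeArc G.rot A) h h' := by
  refine quotEq_congr (fun x y hxy => ?_) fun _ _ => quotEq_swap_mul he
  have := quotEq_swap_mul he hxy
  rwa [dualAt, Equiv.swap_mul_self_mul] at this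

theorem quotEq_vert_dualAt_iff (he : e ∈ A) :
    QuotEq ((G.dualAt e).Joined A) ((G.dualAt e).vert h) ((G.dualAt e).vert h') ↔
      QuotEq (G.Joined A) (G.vert h) (G.vert h') := by
  rw [quotEq_vert_iff, quotEq_vert_iff, quotEq_halfEdgeArc_dualAt_iff he]

variable [Finite V] [Finite E]

theorem k_dualAt (he : e ∈ A) : (G.dualAt e).k A = G.k A := by
  rw [k_eq_card_add, k_eq_card_add, numIsolated_dualAt]
  exact congrArg (· + G.numIsolated) (card_quot_eq_of_quotEq
    (fun _ _ hxy => (quotEq_halfEdgeArc_dualAt_iff he).1 (Quot.sound hxy))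
    (fun _ _ hxy => (quotEq_halfEdgeArc_dualAt_iff he).2 (Quot.sound hxy)))

theorem dualAt_feasible_iff : (G.dualAt e).D.Feasible A ↔ (G.dualAt e).f A = G.k Set.univ := by
  rw [← k_dualAt (Set.mem_univ e)]
  rfl

theorem dualAt_feasible_insert_iff (he : e ∉ A) :
    (G.dualAt e).D.Feasible (insert e A) ↔ G.D.Feasible A := by
  rw [dualAt_feasible_iff, f_dualAt_insert he]
  rfl

theorem D_dualAt (ht : G.twisted e = false) : (G.dualAt e).D = G.D.twist {e} := by
  suffices ∀ A, (G.dualAt e).D.Feasible A ↔ (G.D.twist {e}).Feasible A from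
    congrArg SetSystem.mk (funext fun A => propext (this A))
  refine (SetSystem.forall_iff_forall_notMem (e := e)).2 fun A he => ⟨?_, ?_⟩
  · rw [SetSystem.twist_singleton_feasible_iff, SetSystem.symmDiff_singleton_of_notMem he,
      dualAt_feasible_iff, f_dualAt_of_notMem ht he]
    rfl
  · rw [SetSystem.twist_singleton_feasible_iff, SetSystem.symmDiff_singleton_insert he,
      dualAt_feasible_insert_iff he]

/-- Filling in `e` as in `A`, as in `insert e A` or as in the dual, two of the numbers of boundary
components agree and the third is larger by one. -/
theorem feasible_insert_iff_of_twisted (ht : G.twisted e = true) (he : e ∉ A) :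
    (G.D.Feasible A ↔ G.D.Feasible (insert e A)) ↔ ¬ (G.dualAt e).D.Feasible A := by
  obtain ⟨p, hp, -, hcount⟩ := exists_boundaryCount_eq (ρ := G.rot) (σ := G.state A) (e := e)
    fun f _ => state_ne_zero f
  have absent := hcount (G.state A) (fun _ _ => rfl) (state_ne_zero e)
  have twisted := hcount (G.state (insert e A)) (fun f hf => state_insert_of_ne hf)
    (state_ne_zero e)
  have untwisted := hcount (Function.update (G.state A) e (true, true))
    (fun f hf => Function.update_of_ne hf _ _) (by simp [Prod.ext_iff])
  have f_dual : (G.dualAt e).f A =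
      boundaryCount G.rot (Function.update (G.state A) e (true, true)) + G.numIsolated := by
    refine f_dualAt (fun f hf => Function.update_of_ne hf _ _) ?_
    rw [state_of_notMem he, Function.update_self]
    rfl
  have k_le (B : Set E) : G.k Set.univ ≤ G.f B := (k_anti (Set.subset_univ B)).trans (k_le_f B)
  have k_le_A := k_le A
  have k_le_insert := k_le (insert e A)
  rw [state_of_notMem he] at absent
  rw [state_of_mem (Set.mem_insert e A), ht] at twisted
  rw [Function.update_self] at untwisted
  rw [dualAt_feasible_iff, f_dual]
  rw [f_eq_boundaryCount_add] at k_le_A k_le_insert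
  simp only [D, f_eq_boundaryCount_add]
  have nonzero_shift : ∀ p : Bool × Bool,
      p ≠ 0 → p = (false, true) ∨ p = (true, false) ∨ p = (true, true) := by
    decide
  rcases nonzero_shift p hp with rfl | rfl | rfl
  all_goals
    simp only [↓reduceIte, add_zero, Bool.not_true, Prod.mk.injEq, Bool.true_eq_false,
      Bool.false_eq_true, and_self, and_true, and_false] at absent twisted untwisted
    omega

end PartialDual

section DualAtLoop

variable {V E : Type*} [DecidableEq E] {G : RibbonGraph V E} {e : E} {h h' : E × Bool}

theorem IsLoop.vert_eq_iff_dualAt (he : G.IsLoop e) : G.vert h = G.vert h' ↔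
    (G.dualAt e).vert h = (G.dualAt e).vert h' ∨
      ((G.dualAt e).vert h = (G.dualAt e).vert (e, false) ∧
        (G.dualAt e).vert h' = (G.dualAt e).vert (e, true)) ∨
      ((G.dualAt e).vert h = (G.dualAt e).vert (e, true) ∧
        (G.dualAt e).vert h' = (G.dualAt e).vert (e, false)) := by
  rw [← quotEq_joined_singleton_iff, quotEq_vert_dualAt_iff (Set.mem_singleton e),
    quotEq_joined_singleton_iff, he]
  grind

theorem vert_dualAt_iterate_eq_iff [Finite E] {i m : ℕ}
    (hm : m < Function.minimalPeriod G.rot (e, false)) (hme : G.rot^[m] (e, false) = (e, true))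
    (hi : i < Function.minimalPeriod G.rot (e, false)) :
    (G.dualAt e).vert (G.rot^[i] (e, false)) = (G.dualAt e).vert (e, false) ↔ i < m := by
  have hm0 : 0 < m := Nat.pos_of_ne_zero fun h => by simp [h] at hme
  rw [eq_comm, (G.dualAt e).vert_eq_iff, ← sameCycle_swap_mul_iterate_iff hm0 hm hi, hme]
  rfl

theorem IsLoop.not_isLoop_dualAt [Finite E] (he : G.IsLoop e) : ¬ (G.dualAt e).IsLoop e := by
  obtain ⟨m, hm, hme⟩ := exists_iterate_eq_of_sameCycle ((G.vert_eq_iff _ _).1 he)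
  have := vert_dualAt_iterate_eq_iff hm hme hm
  rw [hme] at this
  exact fun h => lt_irrefl m (this.1 h.symm)

theorem IsLoop.k_dualAt_empty [Finite V] [Finite E] (he : G.IsLoop e) :
    (G.dualAt e).k ∅ = G.k ∅ + 1 := by
  rw [← k_insert_of_quotEq (congrArg _ he), ← k_dualAt (Set.mem_insert e ∅), k_insert_add_one]
  exact fun h => he.not_isLoop_dualAt (quotEq_joined_empty_iff.1 h)

end DualAtLoop

end RibbonGraph

theorem apply_add_one_eq_of_forall_ne {X : Type*} {n : ℕ} {g : Fin (n + 1) → X}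
    {i₀ : Fin (n + 1)} (hg : ∀ i ≠ i₀, g (i + 1) = g i) : g (i₀ + 1) = g i₀ := by
  classical
  let indicator (i : Fin (n + 1)) : ℤ := if g i = g i₀ then 1 else 0
  have sum_zero : ∑ i, (indicator (i + 1) - indicator i) = 0 := by
    rw [Finset.sum_sub_distrib, sub_eq_zero]
    exact Equiv.sum_comp (Equiv.addRight 1) indicator
  rw [Finset.sum_eq_single i₀ (fun i _ hi => by simp only [indicator, hg i hi, sub_self])
    (by simp)] at sum_zero
  by_contra h
  simp [indicator, h] at sum_zero

theorem reachable_fromRel_of_quotEq {X : Type*} {r : X → X → Prop} {x y : X} (h : QuotEq r x y) :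
    (SimpleGraph.fromRel r).Reachable x y := by
  refine SimpleGraph.ConnectedComponent.exact
    (congrArg (Quot.lift (SimpleGraph.fromRel r).connectedComponentMk fun a b hab => ?_) h)
  by_cases hne : a = b
  · rw [hne]
  · exact SimpleGraph.ConnectedComponent.sound
      (SimpleGraph.Adj.reachable ((SimpleGraph.fromRel_adj ..).2 ⟨hne, .inl hab⟩))

namespace RibbonGraph

section Cycles

variable {V E : Type*} {G : RibbonGraph V E} {C : Set E} {e : E}
  {x y a b c d β δ : E × Bool}

theorem eq_or_eq_opposite (hxy : x.1 = y.1) : x = y ∨ x = (y.1, !y.2) := by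
  obtain ⟨f, i⟩ := x
  obtain ⟨g, j⟩ := y
  obtain rfl : f = g := hxy
  cases i <;> cases j <;> simp

theorem quotEq_vert_opposite {A : Set E} (hx : x.1 ∈ A) :
    QuotEq (G.Joined A) (G.vert (x.1, !x.2)) (G.vert x) := by
  have ends : QuotEq (G.Joined A) (G.vert (x.1, false)) (G.vert (x.1, true)) :=
    Quot.sound ⟨x.1, hx, rfl, rfl⟩
  obtain ⟨f, _ | _⟩ := x
  exacts [ends.symm, ends]

theorem CyclicOrder.rotate (h : G.CyclicOrder a b c d) : G.CyclicOrder c d a b := by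
  obtain ⟨i, j, k, hi, hij, hjk, hk, rfl, rfl, rfl⟩ := h
  have periodic : a ∈ Function.periodicPts G.rot :=
    Function.minimalPeriod_pos_iff_mem_periodicPts.1 (by omega)
  set p := Function.minimalPeriod G.rot a
  have iterate_period : G.rot^[p] a = a := Function.iterate_minimalPeriod
  refine ⟨k - j, p - j, p - j + i, by omega, by omega, by omega, ?_, ?_, ?_, ?_⟩
  · rw [Function.minimalPeriod_apply_iterate periodic]
    omega
  · rw [← Function.iterate_add_apply, Nat.sub_add_cancel hjk.le]
  · rw [← Function.iterate_add_apply, Nat.sub_add_cancel (by omega), iterate_period]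
  · rw [← Function.iterate_add_apply, show p - j + i + j = i + p by omega,
      Function.iterate_add_apply, iterate_period]

theorem CyclicOrder.ne (h : G.CyclicOrder a b c d) : a ≠ c := by
  obtain ⟨i, j, k, hi, hij, hjk, hk, -, rfl, -⟩ := h
  exact fun hj => Function.not_isPeriodicPt_of_pos_of_lt_minimalPeriod (by omega)
    (by omega : j < Function.minimalPeriod G.rot a) hj.symm

theorem CyclicOrder.loop_ends (h : G.CyclicOrder a b c d) (ha : a.1 = e) (hc : c.1 = e) :
    G.CyclicOrder (e, false) b (e, true) d ∨ G.CyclicOrder (e, false) d (e, true) b := by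
  obtain rfl : c = (a.1, !a.2) :=
    (eq_or_eq_opposite (hc.trans ha.symm)).resolve_left h.ne.symm
  obtain ⟨_, _ | _⟩ := a <;> obtain rfl := ha
  exacts [.inl h, .inr h.rotate]

theorem IsLoop.vert_eq (he : G.IsLoop e) (hx : x.1 = e) : G.vert x = G.vert (e, false) := by
  obtain rfl | rfl := eq_or_eq_opposite (y := (e, false)) hx
  exacts [rfl, he.symm]

theorem IsLoop.vertices_singleton (he : G.IsLoop e) : G.vertices {e} = {G.vert (e, false)} := by
  ext v
  constructor
  · rintro ⟨x, hx, rfl⟩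
    exact he.vert_eq hx
  · rintro rfl
    exact ⟨(e, false), rfl, rfl⟩

theorem IsLoop.interlaced_iff (he : G.IsLoop e) : G.Interlaced {e} C ↔
    ∃ β δ, β.1 ∈ C ∧ δ.1 ∈ C ∧ G.CyclicOrder (e, false) β (e, true) δ := by
  constructor
  · rintro ⟨-, -, a, β, c, δ, ha, hβ, hc, hδ, -, horder⟩
    rcases horder.loop_ends ha hc with h | h
    exacts [⟨β, δ, hβ, hδ, h⟩, ⟨δ, β, hδ, hβ, h⟩]
  · rintro ⟨β, δ, hβ, hδ, horder⟩
    refine ⟨G.vert (e, false), ?_, (e, false), β, (e, true), δ, rfl, hβ, rfl, hδ, rfl, horder⟩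
    obtain ⟨i, j, k, -, -, -, -, rfl, -⟩ := horder
    rw [he.vertices_singleton, Set.inter_eq_left, Set.singleton_subset_iff]
    exact ⟨_, hβ, ((G.vert_eq_iff _ _).2 ⟨i, by simp [Equiv.Perm.iterate_eq_pow]⟩).symm⟩

theorem IsLoop.eq_singleton_of_isCycle (he : G.IsLoop e) (hC : G.IsCycle C) (heC : e ∈ C) :
    C = {e} := by
  obtain ⟨n, h, -, vert_injective, closes, rfl⟩ := hC
  obtain ⟨i, rfl⟩ := heC
  have : i = i + 1 := vert_injective
    ((he.vert_eq rfl).trans ((he.vert_eq (x := ((h i).1, !(h i).2)) rfl).symm.trans (closes i)))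
  have : Subsingleton (Fin (n + 1)) :=
    Fin.subsingleton_iff_le_one.2 (Fin.one_eq_zero_iff.1 (left_eq_add.1 this)).le
  exact (Set.subsingleton_range _).eq_singleton_of_mem ⟨i, rfl⟩

end Cycles

section Paths

variable {V E : Type*} {G : RibbonGraph V E} {A : Set E} {u w : V} {n : ℕ}
  {x : Fin (n + 1) → E × Bool}

/-- The half-edges `x` are the first halves of the edges of a path from `u` to `w` in `(V, A)`,
traversed through distinct vertices. -/
structure IsPath (G : RibbonGraph V E) (A : Set E) (u w : V) {n : ℕ}
    (x : Fin (n + 1) → E × Bool) : Prop where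
  mem : ∀ i, (x i).1 ∈ A
  vert_injective : Function.Injective fun i => G.vert (x i)
  vert_ne : ∀ i, G.vert (x i) ≠ w
  vert_zero : G.vert (x 0) = u
  vert_last : G.vert ((x (Fin.last n)).1, !(x (Fin.last n)).2) = w
  vert_next : ∀ i ≠ Fin.last n, G.vert ((x i).1, !(x i).2) = G.vert (x (i + 1))

theorem IsPath.fst_injective (h : G.IsPath A u w x) : Function.Injective fun i => (x i).1 := by
  have next {i j : Fin (n + 1)} (hij : x i = ((x j).1, !(x j).2)) : (i : ℕ) = j + 1 := by
    have hj : j ≠ Fin.last n := by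
      rintro rfl
      exact h.vert_ne i (hij ▸ h.vert_last)
    rw [← Fin.val_add_one_of_lt (Fin.lt_last_iff_ne_last.2 hj)]
    exact congrArg _ (h.vert_injective ((congrArg G.vert hij).trans (h.vert_next j hj)))
  intro i j hij
  rcases eq_or_eq_opposite hij with hij | hij
  · exact h.vert_injective (congrArg G.vert hij)
  · have hji : x j = ((x i).1, !(x i).2) := by rw [hij, Bool.not_not]
    have := next hij
    have := next hji
    omega

theorem exists_isPath (huw : u ≠ w) (h : QuotEq (G.Joined A) u w) :
    ∃ (n : ℕ) (x : Fin (n + 1) → E × Bool), G.IsPath A u w x := by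
  obtain ⟨p, hp⟩ := (reachable_fromRel_of_quotEq h).exists_isPath
  obtain ⟨n, hn⟩ : ∃ n, p.length = n + 1 :=
    Nat.exists_eq_succ_of_ne_zero fun hp => huw (SimpleGraph.Walk.eq_of_length_eq_zero hp)
  have getVert_inj {i j : ℕ} (hi : i ≤ n + 1) (hj : j ≤ n + 1)
      (hij : p.getVert i = p.getVert j) : i = j :=
    hp.getVert_injOn (hn ▸ hi) (hn ▸ hj) hij
  have getVert_end : p.getVert (n + 1) = w := hn ▸ p.getVert_length
  have exists_halfEdge (i : Fin (n + 1)) : ∃ y : E × Bool, y.1 ∈ A ∧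
      G.vert y = p.getVert i ∧ G.vert (y.1, !y.2) = p.getVert (i + 1) := by
    rcases ((SimpleGraph.fromRel_adj ..).1 (p.adj_getVert_succ (i := i) (by omega))).2 with
      ⟨f, hf, h₁, h₂⟩ | ⟨f, hf, h₁, h₂⟩
    exacts [⟨(f, false), hf, h₁, h₂⟩, ⟨(f, true), hf, h₂, h₁⟩]
  choose x mem vert_x vert_opposite using exists_halfEdge
  refine ⟨n, x, mem, fun i j hij => ?_, fun i hi => ?_, ?_, ?_, fun i hi => ?_⟩
  · exact Fin.ext (getVert_inj (by omega) (by omega) (by rwa [← vert_x, ← vert_x]))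
  · have := getVert_inj (by omega) le_rfl ((vert_x i).symm.trans (hi.trans getVert_end.symm))
    omega
  · rw [vert_x, Fin.val_zero, p.getVert_zero]
  · rw [vert_opposite, Fin.val_last, getVert_end]
  · rw [vert_opposite, vert_x, Fin.val_add_one_of_lt (Fin.lt_last_iff_ne_last.2 hi)]

end Paths

section CyclesOfDual

variable {V E : Type*} [DecidableEq E] {G : RibbonGraph V E} {C : Set E} {e : E}
  {x y β δ : E × Bool}

theorem IsLoop.cyclicOrder_iff [Finite E] (he : G.IsLoop e) :
    G.CyclicOrder (e, false) β (e, true) δ ↔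
    β ≠ (e, false) ∧ (G.dualAt e).vert β = (G.dualAt e).vert (e, false) ∧
      δ ≠ (e, true) ∧ (G.dualAt e).vert δ = (G.dualAt e).vert (e, true) := by
  obtain ⟨m, hm, hme⟩ := exists_iterate_eq_of_sameCycle ((G.vert_eq_iff _ _).1 he)
  have on_vertex {i : ℕ} : G.vert (e, false) = G.vert (G.rot^[i] (e, false)) :=
    (G.vert_eq_iff _ _).2 ⟨i, by simp [Equiv.Perm.iterate_eq_pow]⟩
  constructor
  · rintro ⟨i, j, k, hi, hij, hjk, hk, rfl, hj, rfl⟩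
    obtain rfl : j = m := (iterate_inj_of_lt_minimalPeriod (by omega) hm).1 (hj.trans hme.symm)
    refine ⟨?_, (vert_dualAt_iterate_eq_iff hm hme (by omega)).2 hij, ?_, ?_⟩
    · rw [Ne, ← Function.iterate_zero_apply G.rot (e, false), ← Function.iterate_add_apply,
        iterate_inj_of_lt_minimalPeriod (by omega) (by omega)]
      omega
    · rw [← hme, Ne, iterate_inj_of_lt_minimalPeriod (by omega) (by omega)]
      omega
    · have := (vert_dualAt_iterate_eq_iff hm hme hk).not.2 (by omega)
      grind [he.vert_eq_iff_dualAt.1 (on_vertex (i := k))]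
  · rintro ⟨hβ, hβv, hδ, hδv⟩
    have hβ_vertex : G.vert (e, false) = G.vert β := he.vert_eq_iff_dualAt.2 (.inl hβv.symm)
    have hδ_vertex : G.vert (e, false) = G.vert δ :=
      he.trans (he.vert_eq_iff_dualAt.2 (.inl hδv.symm))
    obtain ⟨i, hi, rfl⟩ := exists_iterate_eq_of_sameCycle ((G.vert_eq_iff _ _).1 hβ_vertex)
    obtain ⟨k, hk, rfl⟩ := exists_iterate_eq_of_sameCycle ((G.vert_eq_iff _ _).1 hδ_vertex)
    have him := (vert_dualAt_iterate_eq_iff hm hme hi).1 hβv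
    have hkm := (vert_dualAt_iterate_eq_iff hm hme hk).not.1
      fun h => he.not_isLoop_dualAt (h.symm.trans hδv)
    refine ⟨i, m, k, Nat.pos_of_ne_zero ?_, him, lt_of_le_of_ne (not_lt.1 hkm) ?_, hk,
      rfl, hme, rfl⟩
    · rintro rfl
      exact hβ rfl
    · rintro rfl
      exact hδ hme

theorem IsLoop.quotEq_dualAt_of_isCycle (he : G.IsLoop e) (hC : G.IsCycle C) (heC : e ∉ C)
    (hx : x.1 ∈ C) (hxe : G.vert x = G.vert (e, false)) (hy : y.1 ∈ C)
    (hye : G.vert y = G.vert (e, false)) :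
    QuotEq ((G.dualAt e).Joined {e}ᶜ) ((G.dualAt e).vert x) ((G.dualAt e).vert y) := by
  obtain ⟨n, h, -, vert_injective, closes, rfl⟩ := hC
  let component (z : E × Bool) := Quot.mk ((G.dualAt e).Joined {e}ᶜ) ((G.dualAt e).vert z)
  have component_opposite (i : Fin (n + 1)) : component ((h i).1, !(h i).2) = component (h i) :=
    quotEq_vert_opposite fun hi => heC ⟨i, hi⟩
  have component_next {i : Fin (n + 1)} (hi : G.vert (h (i + 1)) ≠ G.vert (e, false)) :
      component (h (i + 1)) = component (h i) := by
    rw [← component_opposite i]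
    refine congrArg (Quot.mk _) ?_
    rcases he.vert_eq_iff_dualAt.1 (closes i).symm with hv | ⟨hv, -⟩ | ⟨hv, -⟩
    · exact hv
    · exact (hi (he.vert_eq_iff_dualAt.2 (.inl hv))).elim
    · exact (hi ((he.vert_eq_iff_dualAt.2 (.inl hv)).trans he.symm)).elim
  obtain ⟨i₀, hi₀⟩ : ∃ i₀, G.vert (h (i₀ + 1)) = G.vert (e, false) := by
    obtain ⟨j, hj⟩ := hx
    obtain rfl | rfl := eq_or_eq_opposite (y := h j) hj.symm
    · exact ⟨j - 1, by rwa [sub_add_cancel]⟩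
    · exact ⟨j, (closes j).symm.trans hxe⟩
  have only_visit {i : Fin (n + 1)} (hi : G.vert (h i) = G.vert (e, false)) : i = i₀ + 1 :=
    vert_injective (hi.trans hi₀.symm)
  have component_around : component (h (i₀ + 1)) = component (h i₀) :=
    apply_add_one_eq_of_forall_ne (g := fun i => component (h i)) fun i hi =>
      component_next fun hie => hi (add_right_cancel (only_visit hie))
  have component_at_loop {z : E × Bool} (hz : z.1 ∈ Set.range fun i => (h i).1)
      (hze : G.vert z = G.vert (e, false)) : component z = component (h i₀) := by
    obtain ⟨j, hj⟩ := hz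
    obtain rfl | rfl := eq_or_eq_opposite (y := h j) hj.symm
    · rw [only_visit hze, component_around]
    · rw [component_opposite, add_right_cancel (only_visit ((closes j).symm.trans hze))]
  exact (component_at_loop hx hxe).trans (component_at_loop hy hye).symm

theorem IsPath.isCycle_of_dualAt (he : G.IsLoop e) {n : ℕ} {x : Fin (n + 1) → E × Bool}
    (hx : (G.dualAt e).IsPath {e}ᶜ ((G.dualAt e).vert (e, false)) ((G.dualAt e).vert (e, true)) x) :
    G.IsCycle (Set.range fun i => (x i).1) := by
  have vert_eq_of_dualAt {h h' : E × Bool} (hh : (G.dualAt e).vert h = (G.dualAt e).vert h') :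
      G.vert h = G.vert h' :=
    he.vert_eq_iff_dualAt.2 (.inl hh)
  refine ⟨n, x, hx.fst_injective, fun i j hij => ?_, fun i => ?_, rfl⟩
  · rcases he.vert_eq_iff_dualAt.1 hij with h | ⟨-, h⟩ | ⟨h, -⟩
    exacts [hx.vert_injective h, (hx.vert_ne j h).elim, (hx.vert_ne i h).elim]
  · by_cases hi : i = Fin.last n
    · rw [hi, Fin.last_add_one, vert_eq_of_dualAt hx.vert_last, vert_eq_of_dualAt hx.vert_zero]
      exact he.symm
    · exact vert_eq_of_dualAt (hx.vert_next i hi)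

variable [Finite V] [Finite E]

theorem IsLoop.isTrivialLoop_iff_isBridge_dualAt (he : G.IsLoop e) :
    G.IsTrivialLoop e ↔ (G.dualAt e).IsBridge e := by
  rw [isBridge_iff]
  constructor
  · rintro ⟨-, htrivial⟩ hconn
    obtain ⟨n, x, hx⟩ := exists_isPath he.not_isLoop_dualAt hconn
    refine htrivial _ (hx.isCycle_of_dualAt he) (he.interlaced_iff.2
      ⟨x 0, ((x (Fin.last n)).1, !(x (Fin.last n)).2), ⟨0, rfl⟩, ⟨Fin.last n, rfl⟩, ?_⟩)
    exact he.cyclicOrder_iff.2 ⟨fun h => hx.mem 0 (congrArg Prod.fst h), hx.vert_zero,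
      fun h => hx.mem (Fin.last n) (congrArg Prod.fst h), hx.vert_last⟩
  · refine fun hbridge => ⟨he, fun C hC hinterlaced => hbridge ?_⟩
    obtain ⟨β, δ, hβ, hδ, horder⟩ := he.interlaced_iff.1 hinterlaced
    obtain ⟨hβ_ne, hβe, -, hδe⟩ := he.cyclicOrder_iff.1 horder
    have heC : e ∉ C := by
      intro heC
      rw [he.eq_singleton_of_isCycle hC heC] at hβ
      obtain rfl : β = (e, true) :=
        (eq_or_eq_opposite (y := (e, false)) hβ).resolve_left hβ_ne
      exact he.not_isLoop_dualAt hβe.symm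
    rw [← hβe, ← hδe]
    refine he.quotEq_dualAt_of_isCycle hC heC hβ ?_ hδ ?_
    · exact he.vert_eq_iff_dualAt.2 (.inl hβe)
    · exact (he.vert_eq_iff_dualAt.2 (.inl hδe)).trans he.symm

end CyclesOfDual

end RibbonGraph

namespace SetSystem

variable {E : Type*} {D : SetSystem E} {e : E}

theorem isColoop_iff_forall_notMem : D.IsColoop e ↔ ∀ A, e ∉ A → ¬ D.Feasible A :=
  forall_congr' fun _ => not_imp_not.symm

theorem isLoop_iff_forall_notMem : D.IsLoop e ↔ ∀ A, e ∉ A → ¬ D.Feasible (insert e A) := by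
  refine (forall_iff_forall_notMem (e := e)).trans (forall₂_congr fun A he => ?_)
  simp only [he, not_false_eq_true, implies_true, true_and, Set.mem_insert, not_true_eq_false,
    imp_false]

theorem isColoop_twist_singleton_iff : (D.twist {e}).IsColoop e ↔ D.IsLoop e := by
  rw [isColoop_iff_forall_notMem, isLoop_iff_forall_notMem]
  refine forall₂_congr fun A he => ?_
  rw [twist_singleton_feasible_iff, symmDiff_singleton_of_notMem he]

theorem IsTrivialRibbonLoop.isRibbonLoop (h : D.IsTrivialRibbonLoop e) : D.IsRibbonLoop e :=
  h.elim (fun h => h.1.1) fun h => h.1.1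

end SetSystem

namespace RibbonGraph

variable {V E : Type*} [Finite V] [Finite E] {G : RibbonGraph V E} {T : Set E} {e : E}

theorem IsLoop.not_feasible_dualAt_of_isForest [DecidableEq E] (he : G.IsLoop e)
    (hT : G.IsForest T) : ¬ (G.dualAt e).D.Feasible T := by
  intro hfeasible
  have k_dual_T : (G.dualAt e).k T = G.k Set.univ :=
    (k_eq_of_feasible hfeasible).trans (k_dualAt (Set.mem_univ e))
  have card_dual := card_le_k_add_ncard (G := G.dualAt e) T
  rw [← k_empty (G := G.dualAt e), he.k_dualAt_empty, k_empty, k_dual_T, ← hT] at card_dual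
  have := k_anti (G := G) (Set.subset_univ T)
  omega

theorem IsLoop.feasible_insert_of_isForest (he : G.IsLoop e) (ht : G.twisted e = true)
    (hT : G.IsForest T) (hTk : G.k T = G.k Set.univ) : G.D.Feasible (insert e T) := by
  classical
  exact ((feasible_insert_iff_of_twisted ht (he.notMem_of_isForest hT)).2
    (he.not_feasible_dualAt_of_isForest hT)).1 (hT.feasible_iff.2 hTk)

theorem IsLoop.isRibbonLoop_twist_of_twisted (he : G.IsLoop e) (ht : G.twisted e = true) :
    (G.D.twist {e}).IsRibbonLoop e := by
  rintro F ⟨hF, hmin⟩ heF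
  obtain ⟨A, heA, rfl⟩ : ∃ A, e ∉ A ∧ insert e A = F :=
    ⟨F \ {e}, by simp, Set.insert_sdiff_self_of_mem heF⟩
  rw [SetSystem.twist_singleton_feasible_iff, SetSystem.symmDiff_singleton_insert heA] at hF
  obtain ⟨T, -, hT, hTk⟩ := exists_spanning_forest G Set.univ
  have card_A_lt_card_T := hmin T <| by
    rw [SetSystem.twist_singleton_feasible_iff,
      SetSystem.symmDiff_singleton_of_notMem (he.notMem_of_isForest hT)]
    exact he.feasible_insert_of_isForest ht hT hTk
  have card_T_le_card_A := card_le_k_add_ncard (G := G) A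
  rw [← hT, k_eq_of_feasible hF, hTk] at card_T_le_card_A
  rw [Set.ncard_insert_of_notMem heA] at card_A_lt_card_T
  omega

theorem IsLoop.isRibbonLoop_twist_iff (he : G.IsLoop e) :
    (G.D.twist {e}).IsRibbonLoop e ↔ G.twisted e = true := by
  classical
  refine ⟨fun h => ?_, he.isRibbonLoop_twist_of_twisted⟩
  by_contra ht
  rw [← D_dualAt (Bool.not_eq_true _ ▸ ht), ← isLoop_iff_isRibbonLoop] at h
  exact he.not_isLoop_dualAt h

theorem isOrientableLoop_iff_isOrientableRibbonLoop :
    G.IsOrientableLoop e ↔ G.D.IsOrientableRibbonLoop e := by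
  rw [IsOrientableLoop, SetSystem.IsOrientableRibbonLoop, ← isLoop_iff_isRibbonLoop]
  refine and_congr_right fun he => ?_
  rw [he.isRibbonLoop_twist_iff, Bool.not_eq_true]

theorem IsOrientableLoop.isTrivialLoop_iff_isLoop (he : G.IsOrientableLoop e) :
    G.IsTrivialLoop e ↔ G.D.IsLoop e := by
  classical
  rw [he.1.isTrivialLoop_iff_isBridge_dualAt, ← isColoop_iff_isBridge, D_dualAt he.2,
    SetSystem.isColoop_twist_singleton_iff]

theorem IsLoop.isTrivialLoop_iff_of_twisted (he : G.IsLoop e) (ht : G.twisted e = true) :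
    G.IsTrivialLoop e ↔ ∀ F, G.D.Feasible F → G.D.Feasible (symmDiff F {e}) := by
  classical
  rw [he.isTrivialLoop_iff_isBridge_dualAt, ← isColoop_iff_isBridge,
    SetSystem.isColoop_iff_forall_notMem]
  refine (forall₂_congr fun A heA => ?_).trans (SetSystem.forall_iff_forall_notMem (e := e)).symm
  rw [← feasible_insert_iff_of_twisted ht heA, SetSystem.symmDiff_singleton_of_notMem heA,
    SetSystem.symmDiff_singleton_insert heA]
  exact iff_iff_implies_and_implies

theorem isTrivialLoop_iff_isTrivialRibbonLoop :
    G.IsTrivialLoop e ↔ G.D.IsTrivialRibbonLoop e := by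
  by_cases he : G.IsLoop e
  · have ribbon : G.D.IsRibbonLoop e := isLoop_iff_isRibbonLoop.1 he
    rw [SetSystem.IsTrivialRibbonLoop, SetSystem.IsOrientableRibbonLoop,
      SetSystem.IsNonorientableRibbonLoop, he.isRibbonLoop_twist_iff]
    cases ht : G.twisted e
    · rw [IsOrientableLoop.isTrivialLoop_iff_isLoop ⟨he, ht⟩]
      simp [ribbon, SetSystem.IsLoop]
    · rw [he.isTrivialLoop_iff_of_twisted ht]
      simp [ribbon]
  · exact iff_of_false (fun h => he h.1) fun h => he (isLoop_iff_isRibbonLoop.2 h.isRibbonLoop)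

theorem isOrientableLoop_of_isLoop_D (he : G.D.IsLoop e) : G.IsOrientableLoop e := by
  have loop : G.IsLoop e := isLoop_iff_isRibbonLoop.2 fun F hF => he F hF.1
  refine ⟨loop, Bool.eq_false_of_not_eq_true fun ht => ?_⟩
  obtain ⟨T, -, hT, hTk⟩ := exists_spanning_forest G Set.univ
  exact he _ (loop.feasible_insert_of_isForest ht hT hTk) (Set.mem_insert e T)

theorem isLoop_D_iff : G.D.IsLoop e ↔ G.IsTrivialLoop e ∧ G.IsOrientableLoop e := by
  constructor
  · intro he
    have orientable := isOrientableLoop_of_isLoop_D he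
    exact ⟨orientable.isTrivialLoop_iff_isLoop.2 he, orientable⟩
  · exact fun ⟨htrivial, he⟩ => he.isTrivialLoop_iff_isLoop.1 htrivial

end RibbonGraph

theorem propositionp {V E : Type*} [Finite V] [Finite E] (G : RibbonGraph V E) (e : E) :
    (G.IsLoop e ↔ G.D.IsRibbonLoop e) ∧
    (G.IsOrientableLoop e ↔ G.D.IsOrientableRibbonLoop e) ∧
    (G.IsTrivialLoop e ↔ G.D.IsTrivialRibbonLoop e) ∧
    (G.D.IsColoop e ↔ G.IsBridge e) ∧
    (G.D.IsLoop e ↔ G.IsTrivialLoop e ∧ G.IsOrientableLoop e) :=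
  ⟨RibbonGraph.isLoop_iff_isRibbonLoop,
    RibbonGraph.isOrientableLoop_iff_isOrientableRibbonLoop,
    RibbonGraph.isTrivialLoop_iff_isTrivialRibbonLoop,
    RibbonGraph.isColoop_iff_isBridge,
    RibbonGraph.isLoop_D_iff⟩
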